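/- Let $\Bbbk$ be an algebraically closed field of characteristic zero and let $H=\Bbbk[D]$ be the polynomial algebra in one variable. A Lie conformal algebra over $\Bbbk$ is a unital left $H$-module $L$ with $\Bbbk$-bilinear products $[\cdot\,{}_{(n)}\,\cdot]:L\times L\to L$, $n\ge 0$, such that for all $a,b,c\in L$ and $n,m\ge 0$ (products with a negative index being zero): \begin{itemize} \item $[a_{(n)}b]=0$ for all sufficiently large $n$ (depending on $a,b$); \item $[Da_{(n)}b]=-n[a_{(n-1)}b]$ and $[a_{(n)}Db]=D[a_{(n)}b]+n[a_{(n-1)}b]$; \item $[a_{(n)}b]=-\sum_{s\ge 0}\frac{(-1)^{n+s}}{s!}D^s[b_{(n+s)}a]$; \item $[a_{(n)}[b_{(m)}c]]-[b_{(m)}[a_{(n)}c]]=\sum_{s\ge 0}\binom{n}{s}[[a_{(n-s)}b]_{(m+s)}c]$. \end{itemize} It is finite if it is finitely generated as an $H$-module, and torsion-free if it has no torsion as an $H$-module. It is solvable if the series $L^{(1)}=L$, $L^{(i+1)}=\operatorname{Span}_{\Bbbk}\{[x_{(n)}y]\mid x,y\in L^{(i)},\ n\ge 0\}$ reaches $0$.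 Let $\Bbbk[t]$ be the right $H$-module with $f(t)\cdot D=-f'(t)$, and put $\mathcal L=\Bbbk[t]\otimes_H L$. The formula $$x_{(n)}(t^m\otimes_H a)=\sum_{s\ge 0}\binom{n}{s}\,t^{m+s}\otimes_H[x_{(n-s)}a],\qquad x,a\in L,\ n,m\ge 0,$$ gives well-defined $\Bbbk$-linear maps $x_{(n)}:\mathcal L\to\mathcal L$. Theorem. Let $L$ be a finite torsion-free solvable Lie conformal algebra over $\Bbbk$. Then there is a (finite) basis $B$ of $L$ over $H$ such that $L$ has the central PBW property with respect to $B$: there is a function $N:B\to\mathbb Z_{>0}$ such that the subspace $$I(B,N)=\operatorname{Span}_{\Bbbk}\{t^m\otimes_H b\mid b\in B,\ m\ge N(b)\}\subseteq\mathcal L$$ satisfies $x_{(n)}I(B,N)\subseteq I(B,N)$ for all $x\in L$ and $n\ge 0$. -/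

import Mathlib

open Polynomial TensorProduct

/-- A conformal algebra over `k`: a module over `H = k[D]` (the polynomial variable `X` is `D`)
with `k`-bilinear `n`-products, `n ≥ 0`, that are local and sesqui-linear.
At `n = 0` the coefficient `n` vanishes, so products of negative index never occur. -/
class ConformalAlgebra (k : Type*) (L : Type*) [Field k] [AddCommGroup L] [Module k L]
    [Module k[X] L] [IsScalarTower k k[X] L] where
  /-- The product `a ∘ₙ b`. -/
  nprod : ℕ → L →ₗ[k] L →ₗ[k] L
  locality : ∀ a b : L, ∃ N : ℕ, ∀ n : ℕ, N ≤ n → nprod n a b = 0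
  D_nprod : ∀ (n : ℕ) (a b : L),
    nprod n ((X : k[X]) • a) b = -((n : k) • nprod (n - 1) a b)
  nprod_D : ∀ (n : ℕ) (a b : L),
    nprod n a ((X : k[X]) • b) = (X : k[X]) • nprod n a b + (n : k) • nprod (n - 1) a b

namespace ConformalAlgebra

section

variable (k : Type*) {L : Type*} [Field k] [AddCommGroup L] [Module k L]
  [Module k[X] L] [IsScalarTower k k[X] L] [ConformalAlgebra k L]

/-- The braced product `{a ∘ₙ b} = ∑ₛ (-1)ⁿ⁺ˢ / s! Dˢ (a ∘ₙ₊ₛ b)`; the sum has only finitely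
many nonzero terms by locality. -/
noncomputable def bracedProd (n : ℕ) (a b : L) : L :=
  ∑ᶠ s : ℕ, ((-1 : k) ^ (n + s) / (s.factorial : k)) •
    ((X : k[X]) ^ s • nprod (k := k) (n + s) a b)

end

/-- A conformal algebra is a Lie conformal algebra if its products satisfy conformal
anti-commutativity and the conformal Jacobi identity. -/
class IsLie (k : Type*) (L : Type*) [Field k] [AddCommGroup L] [Module k L]
    [Module k[X] L] [IsScalarTower k k[X] L] [ConformalAlgebra k L] : Prop where
  skew : ∀ (n : ℕ) (a b : L), nprod (k := k) n a b = -bracedProd k n b a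
  jacobi : ∀ (n m : ℕ) (a b c : L),
    nprod (k := k) n a (nprod (k := k) m b c) - nprod (k := k) m b (nprod (k := k) n a c) =
      ∑ s ∈ Finset.range (n + 1), (n.choose s : k) •
        nprod (k := k) (m + s) (nprod (k := k) (n - s) a b) c

/-- The polynomials `k[t]`, as a module over `H = k[D]` through `f(t) · D = -f'(t)`
(as `H` is commutative, right and left modules are the same). -/
def TPoly (k : Type*) [Field k] : Type _ := k[X]

namespace TPoly

variable (k : Type*) [Field k]

noncomputable instance : AddCommGroup (TPoly k) := inferInstanceAs (AddCommGroup k[X])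

noncomputable instance : Module k (TPoly k) := inferInstanceAs (Module k k[X])

/-- The identification of `k[t]` with the underlying space of the module `TPoly k`. -/
noncomputable def of : k[X] ≃ₗ[k] TPoly k := LinearEquiv.refl k k[X]

/-- The operator `-d/dt`. -/
noncomputable def negDeriv : Module.End k (TPoly k) :=
  (of k).conj (-(derivative : k[X] →ₗ[k] k[X]))

/-- `p(D)` acts as `p(-d/dt)`. -/
noncomputable instance : Module k[X] (TPoly k) :=
  Module.compHom (TPoly k) (aeval (negDeriv k) : k[X] →ₐ[k] Module.End k (TPoly k)).toRingHom

theorem smul_def (p : k[X]) (u : TPoly k) : p • u = aeval (negDeriv k) p u := rfl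

theorem X_smul_of (f : k[X]) : (X : k[X]) • of k f = of k (-derivative f) := by
  simp [smul_def, negDeriv, LinearEquiv.conj_apply]

instance : IsScalarTower k k[X] (TPoly k) where
  smul_assoc c p u := by simp [smul_def]

end TPoly

/-- The space `k[t] ⊗_H L`. -/
abbrev Coeff (k : Type*) (L : Type*) [Field k] [AddCommGroup L] [Module k[X] L] : Type _ :=
  TPoly k ⊗[k[X]] L

section

variable (k : Type*) {L : Type*} [Field k] [AddCommGroup L] [Module k[X] L]

/-- The element `f(t) ⊗_H a` of `k[t] ⊗_H L`. -/
noncomputable def coeffMk (f : k[X]) (a : L) : Coeff k L :=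
  TPoly.of k f ⊗ₜ[k[X]] a

theorem coeffMk_smul (f : k[X]) (a : L) :
    coeffMk k f ((X : k[X]) • a) = -coeffMk k (derivative f) a := by
  unfold coeffMk
  rw [← TensorProduct.smul_tmul, TPoly.X_smul_of]
  simp [TensorProduct.neg_tmul]

variable [Module k L] [IsScalarTower k k[X] L]

/-- `f(t) ⊗_H a` depends bilinearly on `f` and `a`. -/
noncomputable def coeffMkₗ : k[X] →ₗ[k] L →ₗ[k] Coeff k L :=
  LinearMap.mk₂ k (coeffMk k)
    (fun f g a => by simp [coeffMk, TensorProduct.add_tmul])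
    (fun c f a => by simp [coeffMk, TensorProduct.smul_tmul'])
    (fun f a b => by simp [coeffMk, TensorProduct.tmul_add])
    (fun c f a => by simp [coeffMk])

theorem coeffMkₗ_apply (f : k[X]) (a : L) : coeffMkₗ k f a = coeffMk k f a := rfl

end

section

variable (k : Type*) (L : Type*) [Field k] [AddCommGroup L] [Module k L]
  [Module k[X] L] [IsScalarTower k k[X] L] [ConformalAlgebra k L]

/-- The derived series: it starts with `L`, and each further term is the `k`-linear span of all
the products `x ∘ₙ y` of elements `x`, `y` of the previous one. -/
def derivedSeries : ℕ → Submodule k L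
  | 0 => ⊤
  | i + 1 => Submodule.span k
      {z : L | ∃ x ∈ derivedSeries i, ∃ y ∈ derivedSeries i, ∃ n : ℕ,
        z = nprod (k := k) n x y}

/-- Solvability: the derived series reaches zero. -/
def IsSolvable : Prop := ∃ i : ℕ, derivedSeries k L i = ⊥

variable {L}

/-- The map `(f, a) ↦ ∑ₛ (n choose s) tˢ f(t) ⊗_H (x ∘ₙ₋ₛ a)`. -/
noncomputable def centralActionAux (n : ℕ) (x : L) : k[X] →ₗ[k] L →ₗ[k] Coeff k L :=
  ∑ s ∈ Finset.range (n + 1), (n.choose s : k) •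
    (coeffMkₗ k).compl₁₂ (LinearMap.mulLeft k (X ^ s)) (nprod (k := k) (n - s) x)

theorem centralActionAux_apply (n : ℕ) (x : L) (f : k[X]) (a : L) :
    centralActionAux k n x f a = ∑ s ∈ Finset.range (n + 1), (n.choose s : k) •
      coeffMk k (X ^ s * f) (nprod (k := k) (n - s) x a) := by
  simp [centralActionAux, coeffMkₗ_apply, LinearMap.sum_apply]

theorem centralActionAux_smul_X (n : ℕ) (x : L) (f : k[X]) (a : L) :
    centralActionAux k n x f ((X : k[X]) • a) = -centralActionAux k n x (derivative f) a := by
  have h1 : ∀ s ∈ Finset.range (n + 1),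
      (n.choose s : k) • coeffMkₗ k (X ^ s * f) (nprod (k := k) (n - s) x ((X : k[X]) • a)) =
        -((n.choose s : k) • coeffMkₗ k (X ^ s * derivative f) (nprod (k := k) (n - s) x a)) +
        (((n.choose s * (n - s) : ℕ) : k) •
            coeffMkₗ k (X ^ s * f) (nprod (k := k) (n - s - 1) x a) -
          ((n.choose s * s : ℕ) : k) •
            coeffMkₗ k (X ^ (s - 1) * f) (nprod (k := k) (n - s) x a)) := by
    intro s _
    have hd : derivative (X ^ s * f) = (s : k) • (X ^ (s - 1) * f) + X ^ s * derivative f := by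
      simp [derivative_mul, derivative_X_pow, mul_assoc, smul_eq_C_mul]
    have e : coeffMkₗ k (X ^ s * f) ((X : k[X]) • nprod (k := k) (n - s) x a) =
        -coeffMkₗ k (derivative (X ^ s * f)) (nprod (k := k) (n - s) x a) :=
      coeffMk_smul k _ _
    rw [nprod_D, map_add, e, hd]
    simp only [map_add, map_smul, LinearMap.add_apply, LinearMap.smul_apply, Nat.cast_mul]
    module
  have h2 : ∑ s ∈ Finset.range (n + 1), ((n.choose s * (n - s) : ℕ) : k) •
        coeffMkₗ k (X ^ s * f) (nprod (k := k) (n - s - 1) x a) =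
      ∑ s ∈ Finset.range (n + 1), ((n.choose s * s : ℕ) : k) •
        coeffMkₗ k (X ^ (s - 1) * f) (nprod (k := k) (n - s) x a) := by
    rw [Finset.sum_range_succ, Finset.sum_range_succ']
    simp only [Nat.sub_self, Nat.mul_zero, Nat.cast_zero, zero_smul, add_zero]
    refine Finset.sum_congr rfl fun s _ => ?_
    rw [Nat.choose_succ_right_eq, Nat.add_sub_cancel, Nat.sub_sub]
  simp only [centralActionAux_apply, ← coeffMkₗ_apply]
  rw [Finset.sum_congr rfl h1, Finset.sum_add_distrib, Finset.sum_sub_distrib, h2, sub_self,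
    add_zero, Finset.sum_neg_distrib]

theorem centralActionAux_balanced (n : ℕ) (x : L) (p : k[X]) (u : TPoly k) (a : L) :
    centralActionAux k n x ((TPoly.of k).symm (p • u)) a =
      centralActionAux k n x ((TPoly.of k).symm u) (p • a) := by
  obtain ⟨f, rfl⟩ := (TPoly.of k).surjective u
  induction p using Polynomial.induction_on' generalizing f a with
  | add p q hp hq => simp only [add_smul, map_add, LinearMap.add_apply, hp, hq]
  | monomial m c =>
    induction m generalizing f a with
    | zero =>
      rw [monomial_zero_left, ← algebraMap_eq, algebraMap_smul, algebraMap_smul]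
      simp
    | succ m ih =>
      rw [← monomial_mul_X, mul_smul, mul_smul, TPoly.X_smul_of, ih]
      have hc : (monomial m c : k[X]) • (X : k[X]) • a = (X : k[X]) • (monomial m c : k[X]) • a :=
        smul_comm _ _ _
      rw [hc, LinearEquiv.symm_apply_apply, LinearEquiv.symm_apply_apply,
        centralActionAux_smul_X]
      simp

/-- The action of `x ∈ L` on `k[t] ⊗_H L` by the `n`-th product, determined by
`x ∘ₙ (f(t) ⊗_H a) = ∑ₛ (n choose s) tˢ f(t) ⊗_H (x ∘ₙ₋ₛ a)`; see `centralAction_mk`. -/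
noncomputable def centralAction (n : ℕ) (x : L) : Coeff k L →ₗ[k] Coeff k L where
  toFun := TensorProduct.liftAddHom
    (AddMonoidHom.mk' (fun u : TPoly k =>
        (centralActionAux k n x ((TPoly.of k).symm u)).toAddMonoidHom)
      (fun u v => by ext a; simp))
    (fun p u a => centralActionAux_balanced k n x p u a)
  map_add' := fun u v => map_add _ u v
  map_smul' := fun c u => by
    induction u using TensorProduct.induction_on with
    | zero => simp
    | add u v hu hv => simp only [smul_add, map_add, hu, hv]
    | tmul u a =>
      change centralActionAux k n x ((TPoly.of k).symm (c • u)) a =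
        c • centralActionAux k n x ((TPoly.of k).symm u) a
      simp

/-- The defining formula of the action. -/
theorem centralAction_mk (n : ℕ) (x : L) (m : ℕ) (a : L) :
    centralAction k n x (coeffMk k (X ^ m) a) =
      ∑ s ∈ Finset.range (n + 1), (n.choose s : k) •
        coeffMk k (X ^ (m + s)) (nprod (k := k) (n - s) x a) := by
  have h : centralAction k n x (coeffMk k (X ^ m) a) = centralActionAux k n x (X ^ m) a := rfl
  rw [h, centralActionAux_apply]
  simp only [← pow_add, add_comm]

variable {k}

/-- The `k`-linear span of the elements `t^m ⊗_H b` with `b` in the basis and `m ≥ N(b)`. -/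
noncomputable def centralSpan {ι : Type*} (b : Module.Basis ι k[X] L) (N : ι → ℕ) :
    Submodule k (Coeff k L) :=
  Submodule.span k {u | ∃ (i : ι) (m : ℕ), N i ≤ m ∧ u = coeffMk k (X ^ m) (b i)}

/-- The central PBW property with respect to an `H`-basis. -/
def HasCentralPBW {ι : Type*} (b : Module.Basis ι k[X] L) : Prop :=
  ∃ N : ι → ℕ, (∀ i, 0 < N i) ∧
    ∀ (n : ℕ) (x : L), ∀ u ∈ centralSpan b N, centralAction k n x u ∈ centralSpan b N

end

end ConformalAlgebra

set_option linter.unusedSectionVars false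

namespace ConformalAlgebra

/-! The theorem reduces to triangularity. Suppose `L` has an `H`-basis b_0, b_1, … such that each
x_(n) b_i is a scalar multiple of b_i plus an `H`-combination of earlier b_j. Let d bound the
degrees in D of all coordinates of such products. Then N(b_i) = 1 + i·d works
(`hasCentralPBW_of_triangular`): t^m ⊗ D^e b is a multiple of t^(m-e) ⊗ b, so passing to an earlier
basis vector costs at most d powers of t, which its smaller N allows, while the constant diagonal
term costs none.

Such a basis comes from a conformal Lie theorem, applied to the adjoint representation: a solvable
algebra has a common eigenvector in every nonzero finite representation
(`IsConformalRep.exists_eigenvector`). A generator of the saturation of its `H`-span is again an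
eigenvector (`IsSesqui.weight_of_saturated`), the quotient is torsion-free, and induction on the
rank applies.

The Lie theorem climbs the derived series, from J = L^(i+1) to M = L^(i). The representation is
usually infinite-dimensional over k, so finite-dimensional subspaces stable under M must be found.
On the vectors killed by J the operators of M commute, and a filtration by the index from which
generators of M act by zero provides the subspace. For a nonzero weight of J, the weight space W is
finite-dimensional because relations over k[D] among weight vectors can be differentiated. As for
its stability, `exists_shift` shows that ρ_n(x) preserves W up to a multiple cD; locality and
descent on n force c = 0. Commutators of operators of M are then scalars on W, hence zero by the
trace, and a common eigenvector exists. -/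

/-- Induction along the derivative. -/
theorem derivative_induction {k : Type*} [Field k] {P : k[X] → Prop}
    (hP : ∀ p, P (derivative p) → P p)
    (h0 : P 0) (p : k[X]) : P p := by
  induction hn : p.natDegree using Nat.strong_induction_on generalizing p with
  | _ n ih =>
    apply hP
    by_cases h : p.natDegree = 0
    · rw [eq_C_of_natDegree_eq_zero h, derivative_C]; exact h0
    · exact ih _ (hn ▸ natDegree_derivative_lt h) _ rfl

/-! ### Sesquilinear sequences of operators and their weight vectors. -/

section Operators

variable {k V : Type*} [Field k] [AddCommGroup V] [Module k V] [Module k[X] V]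
  [IsScalarTower k k[X] V]

/-- A sequence of operators with the commutation rule `Tₙ D = D Tₙ + n Tₙ₋₁` of the `n`-products
with a fixed element. -/
def IsSesqui (T : ℕ → V →ₗ[k] V) : Prop :=
  ∀ (n : ℕ) (v : V), T n ((X : k[X]) • v) = (X : k[X]) • T n v + (n : k) • T (n - 1) v

/-- A `k`-subspace stable under `X` is stable under `k[X]`. -/
theorem smul_mem_of_X_smul_mem (S : Submodule k V) (hS : ∀ v ∈ S, (X : k[X]) • v ∈ S)
    (p : k[X]) {v : V} (hv : v ∈ S) : p • v ∈ S := by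
  induction p using Polynomial.induction_on' with
  | add p q hp hq => rw [add_smul]; exact add_mem hp hq
  | monomial n c =>
    induction n with
    | zero =>
      rw [monomial_zero_left, ← algebraMap_eq, algebraMap_smul]
      exact S.smul_mem c hv
    | succ n ih =>
      rw [← X_mul_monomial, mul_smul]
      exact hS _ ih

/-- The `k[X]`-submodule with the underlying set of a `k`-subspace stable under `X`. -/
def submoduleOfXSMul (S : Submodule k V) (hS : ∀ v ∈ S, (X : k[X]) • v ∈ S) :
    Submodule k[X] V where
  carrier := S
  add_mem' := S.add_mem
  zero_mem' := S.zero_mem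
  smul_mem' p _ hv := smul_mem_of_X_smul_mem S hS p hv

theorem smul_mem_of_field (W : Submodule k[X] V) (c : k) {v : V} (hv : v ∈ W) : c • v ∈ W := by
  rw [← algebraMap_smul k[X] c v]
  exact W.smul_mem _ hv

theorem C_smul_eq (c : k) (v : V) : (C c : k[X]) • v = c • v := by
  rw [← algebraMap_eq, algebraMap_smul]

/-- With T_λ = ∑ λⁿ/n! Tₙ the rule reads T_λ D = (D + λ) T_λ, so T_λ p(D) = p(D + λ) T_λ; this is
its Taylor expansion. -/
theorem IsSesqui.apply_smul {T : ℕ → V →ₗ[k] V} (hT : IsSesqui T) (p : k[X]) (m : ℕ) (u : V) :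
    T m (p • u) = ∑ i ∈ Finset.range (m + 1), (m.choose i : k) •
      (derivative^[i] p • T (m - i) u) := by
  induction p using Polynomial.induction_on generalizing m with
  | C c =>
    rw [Finset.sum_range_succ']
    simp [iterate_derivative_C, C_smul_eq]
  | add p q hp hq => simp [add_smul, hp, hq, Finset.sum_add_distrib]
  | monomial n c ih =>
    set q : k[X] := C c * X ^ n with hq
    have e : (C c * X ^ (n + 1) : k[X]) = q * X := by rw [hq, pow_succ, mul_assoc]
    have e1 : ∀ i, derivative^[i] (q * X) • T (m - i) u =
        (X : k[X]) • (derivative^[i] q • T (m - i) u) +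
          (i : k) • (derivative^[i - 1] q • T (m - i) u) := by
      intro i
      rw [iterate_derivative_mul_X, add_smul, mul_comm, mul_smul, smul_assoc, Nat.cast_smul_eq_nsmul]
    have e2 : ∑ i ∈ Finset.range (m + 1), (m.choose i : k) • (i : k) •
        (derivative^[i - 1] q • T (m - i) u) = (m : k) • T (m - 1) (q • u) := by
      cases m with
      | zero => simp
      | succ m =>
        rw [Finset.sum_range_succ', ih, Finset.smul_sum]
        simp only [Nat.cast_zero, zero_smul, smul_zero, add_zero, Nat.add_sub_cancel]
        refine Finset.sum_congr rfl fun i _ => ?_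
        rw [smul_smul, smul_smul, ← Nat.cast_mul, ← Nat.cast_mul, ← Nat.add_one_mul_choose_eq,
          Nat.add_sub_add_right]
    rw [e, mul_comm, mul_smul, hT, ih, ← ih, mul_comm]
    simp only [e1, smul_add, Finset.sum_add_distrib, e2]
    rw [ih, Finset.smul_sum]
    congr 1
    refine Finset.sum_congr rfl fun i _ => smul_comm _ _ _

variable {T : ℕ → V →ₗ[k] V}

theorem IsSesqui.map_smul_mem (hT : IsSesqui T) {W : Submodule k[X] V} {u : V}
    (hu : ∀ m, T m u ∈ W) (m : ℕ) (p : k[X]) : T m (p • u) ∈ W := by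
  rw [hT.apply_smul]
  exact sum_mem fun i _ => smul_mem_of_field _ _ (W.smul_mem _ (hu _))

theorem IsSesqui.map_span_mem (hT : IsSesqui T) {W : Submodule k[X] V} {S : Set V}
    (hS : ∀ u ∈ S, ∀ m, T m u ∈ W) {v : V} (hv : v ∈ Submodule.span k[X] S) (m : ℕ) :
    T m v ∈ W := by
  induction hv using Submodule.span_induction generalizing m with
  | mem u hu => exact hS u hu m
  | zero => simp
  | add u v _ _ hu hv => rw [map_add]; exact add_mem (hu m) (hv m)
  | smul p u _ hu => exact hT.map_smul_mem hu m p

/-- The action on `p(D)u` for a weight vector `u` modulo `W`. -/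
theorem IsSesqui.apply_smul_sub_mem (hT : IsSesqui T) {W : Submodule k[X] V} {u : V} {φ : ℕ → k}
    (hu : ∀ m, T m u - φ m • u ∈ W) (p : k[X]) (m : ℕ) :
    T m (p • u) - (∑ i ∈ Finset.range (m + 1), (m.choose i * φ (m - i) : k) •
      derivative^[i] p) • u ∈ W := by
  rw [hT.apply_smul, Finset.sum_smul, ← Finset.sum_sub_distrib]
  refine sum_mem fun i _ => ?_
  have : (m.choose i : k) • derivative^[i] p • T (m - i) u -
      ((m.choose i * φ (m - i) : k) • derivative^[i] p) • u =
      (m.choose i : k) • derivative^[i] p • (T (m - i) u - φ (m - i) • u) := by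
    rw [smul_sub, smul_sub, smul_assoc, mul_smul, smul_comm (φ (m - i)) (derivative^[i] p) u]
  rw [this]
  exact smul_mem_of_field _ _ (W.smul_mem _ (hu _))

/-- Just past the lowest possibly nonzero weight only the terms p and p' of the Taylor expansion
survive. This is how p is differentiated by applying an operator. -/
theorem IsSesqui.apply_smul_sub_mem_of_lt (hT : IsSesqui T) {W : Submodule k[X] V} {u : V}
    {φ : ℕ → k} (hu : ∀ m, T m u - φ m • u ∈ W) (p : k[X]) {m : ℕ} (hm : ∀ j < m, φ j = 0) :
    T (m + 1) (p • u) - (φ (m + 1) • p + ((m + 1 : k) * φ m) • derivative p) • u ∈ W := by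
  have h := hT.apply_smul_sub_mem hu p (m + 1)
  rw [Finset.sum_range_succ', Finset.sum_range_succ'] at h
  have h0 : ∑ i ∈ Finset.range m, (((m + 1).choose (i + 1 + 1) : k) * φ (m + 1 - (i + 1 + 1))) •
      derivative^[i + 1 + 1] p = 0 := by
    refine Finset.sum_eq_zero fun i hi => ?_
    rw [hm _ (by have := Finset.mem_range.1 hi; omega), mul_zero, zero_smul]
  rw [h0] at h
  simpa [add_comm] using h

variable [CharZero k]

/-- A weight vector of nonzero weight is not torsion. -/
theorem IsSesqui.eq_zero_of_smul_mem (hT : IsSesqui T) {W : Submodule k[X] V}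
    (hW : ∀ m, ∀ v ∈ W, T m v ∈ W) {u : V} {φ : ℕ → k} (hu : ∀ m, T m u - φ m • u ∈ W)
    (hφ : ∃ m, φ m ≠ 0) (hu' : u ∉ W) (p : k[X]) (hp : p • u ∈ W) : p = 0 := by
  classical
  induction p using derivative_induction with
  | h0 => rfl
  | hP p ih =>
    -- With m the lowest index of nonzero weight, p' enters with a nonzero coefficient, so p • u in
    -- W forces p' • u in W.
    have h := hT.apply_smul_sub_mem_of_lt hu p (m := Nat.find hφ)
      (fun j hj => not_not.1 (Nat.find_min hφ hj))
    set m := Nat.find hφ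
    have h1 := (Submodule.sub_mem_iff_right W (hW _ _ hp)).1 h
    rw [add_smul] at h1
    have h2 := (Submodule.add_mem_iff_right W (by
      rw [smul_assoc]; exact smul_mem_of_field _ _ hp)).1 h1
    rw [smul_assoc] at h2
    have hne : ((m + 1 : k) * φ m) ≠ 0 :=
      mul_ne_zero (Nat.cast_add_one_ne_zero m) (Nat.find_spec hφ)
    have h3 := smul_mem_of_field W ((m + 1 : k) * φ m)⁻¹ h2
    rw [smul_smul, inv_mul_cancel₀ hne, one_smul] at h3
    have h4 := ih h3
    have h5 := derivative_eq_zero.1 h4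
    rw [eq_C_of_natDegree_eq_zero h5] at hp ⊢
    by_contra hc
    have hc' : p.coeff 0 ≠ 0 := fun h => hc (by rw [h, C_0])
    rw [C_smul_eq] at hp
    have := smul_mem_of_field W (p.coeff 0)⁻¹ hp
    rw [smul_smul, inv_mul_cancel₀ hc', one_smul] at this
    exact hu' this

end Operators

/-! ### Common eigenvectors in finite dimension. -/

section Eigenvectors

variable {k V : Type*} [Field k] [AddCommGroup V] [Module k V]

/-- A family of operators that commute on a stable nonzero subspace of finite dimension has a
common eigenvector there. -/
theorem exists_common_eigenvector_of_commute [IsAlgClosed k] (S : Set (V →ₗ[k] V))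
    (W : Submodule k V) [FiniteDimensional k W] (hW : W ≠ ⊥) (hS : ∀ A ∈ S, ∀ w ∈ W, A w ∈ W)
    (hc : ∀ A ∈ S, ∀ B ∈ S, ∀ w ∈ W, A (B w) = B (A w)) :
    ∃ v ∈ W, v ≠ 0 ∧ ∀ A ∈ S, ∃ c : k, A v = c • v := by
  induction hn : Module.finrank k W using Nat.strong_induction_on generalizing W with
  | _ n ih =>
    by_cases hall : ∀ A ∈ S, ∃ c : k, ∀ w ∈ W, A w = c • w
    · obtain ⟨v, hv, hv0⟩ := Submodule.exists_mem_ne_zero_of_ne_bot hW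
      exact ⟨v, hv, hv0, fun A hA => (hall A hA).imp fun c h => h v hv⟩
    push Not at hall
    obtain ⟨A, hA, hAc⟩ := hall
    have : Nontrivial W := Submodule.nontrivial_iff_ne_bot.2 hW
    obtain ⟨c, hcA⟩ := Module.End.exists_eigenvalue (A.restrict (hS A hA))
    obtain ⟨w, hw⟩ := hcA.exists_hasEigenvector
    let W' : Submodule k V := W ⊓ LinearMap.ker (A - c • LinearMap.id)
    have hmem : ∀ u, u ∈ W' ↔ u ∈ W ∧ A u = c • u := fun u => by
      simp [W', sub_eq_zero]
    have hlt : W' < W := by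
      refine lt_of_le_of_ne inf_le_left fun h => ?_
      obtain ⟨u, hu, hu'⟩ := hAc c
      exact hu' ((hmem u).1 (h ▸ hu)).2
    have hwW : (w : V) ∈ W' := (hmem _).2 ⟨w.2, congrArg Subtype.val hw.apply_eq_smul⟩
    have : FiniteDimensional k W' := Submodule.finiteDimensional_of_le hlt.le
    obtain ⟨v, hv, h⟩ := ih _ (hn ▸ Submodule.finrank_lt_finrank_of_lt hlt) W'
      (fun h => hw.2 (by
        have := h ▸ hwW
        simpa using this))
      (fun B hB u hu => by
        rw [hmem] at hu ⊢
        exact ⟨hS B hB u hu.1, by rw [hc A hA B hB u hu.1, hu.2, map_smul]⟩)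
      (fun B hB C hC u hu => hc B hB C hC u hu.1) rfl
    exact ⟨v, hv.1, h⟩

/-- The same for operators with scalar commutators, in characteristic zero. -/
theorem exists_common_eigenvector [IsAlgClosed k] [CharZero k] (S : Set (V →ₗ[k] V))
    (W : Submodule k V) [FiniteDimensional k W] (hW : W ≠ ⊥) (hS : ∀ A ∈ S, ∀ w ∈ W, A w ∈ W)
    (hc : ∀ A ∈ S, ∀ B ∈ S, ∃ c : k, ∀ w ∈ W, A (B w) - B (A w) = c • w) :
    ∃ v ∈ W, v ≠ 0 ∧ ∀ A ∈ S, ∃ c : k, A v = c • v := by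
  refine exists_common_eigenvector_of_commute S W hW hS fun A hA B hB w hw => ?_
  obtain ⟨c, h⟩ := hc A hA B hB
  set A' : Module.End k W := A.restrict (hS A hA)
  set B' : Module.End k W := B.restrict (hS B hB)
  have e : A' * B' - B' * A' = c • (1 : Module.End k W) := by
    ext u
    exact h u u.2
  -- A commutator has trace zero, so c · dim W = 0 and c = 0 in characteristic zero.
  have ht := congrArg (LinearMap.trace k W) e
  rw [map_sub, LinearMap.trace_mul_comm, sub_self, map_smul, LinearMap.trace_one,
    smul_eq_mul, eq_comm, mul_eq_zero] at ht
  have : Nontrivial W := Submodule.nontrivial_iff_ne_bot.2 hW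
  have h0 : (Module.finrank k W : k) ≠ 0 := Nat.cast_ne_zero.2 Module.finrank_pos.ne'
  have := h w hw
  rwa [ht.resolve_right h0, zero_smul, sub_eq_zero] at this

end Eigenvectors

/-! ### Finite-dimensionality over k from relations over k[D]. -/

section Finiteness

universe u

theorem iterate_derivative_of_natDegree_le {R : Type*} [CommSemiring R] {p : R[X]} {d : ℕ}
    (h : p.natDegree ≤ d) : derivative^[d] p = C (d.factorial * p.coeff d) := by
  ext n
  rw [coeff_iterate_derivative, coeff_C]
  split_ifs with hn
  · simp [hn, Nat.descFactorial_self]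
  · rw [coeff_eq_zero_of_natDegree_lt (by omega), smul_zero]

/-- If a `k`-linearly independent family satisfies the leading coefficients of each of its
`k[X]`-linear relations, then it is `k[X]`-linearly independent. -/
theorem linearIndependent_of_coeff {k V ι : Type*} [Field k] [AddCommGroup V] [Module k V]
    [Module k[X] V] {v : ι → V} (hv : LinearIndependent k v)
    (h : ∀ (s : Finset ι) (l : ι → k[X]) (d : ℕ), (∀ i ∈ s, (l i).natDegree ≤ d) →
      ∑ i ∈ s, l i • v i = 0 → ∑ i ∈ s, (l i).coeff d • v i = 0) :
    LinearIndependent k[X] v := by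
  rw [linearIndependent_iff']
  intro s l hl
  have key : ∀ d : ℕ, (∀ i ∈ s, (l i).natDegree ≤ d) → ∀ i ∈ s, l i = 0 := by
    intro d
    induction d with
    | zero =>
      intro hd i hi
      have := linearIndependent_iff'.1 hv s _ (h s l 0 hd hl) i hi
      rw [eq_C_of_natDegree_le_zero (hd i hi), this, C_0]
    | succ d ih =>
      intro hd
      refine ih fun i hi => ?_
      have := linearIndependent_iff'.1 hv s _ (h s l (d + 1) hd hl) i hi
      refine natDegree_le_iff_coeff_eq_zero.2 fun N hN => ?_
      rcases (Nat.succ_le_of_lt hN).eq_or_lt with rfl | hN'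
      · exact this
      · exact coeff_eq_zero_of_natDegree_lt ((hd i hi).trans_lt hN')
  exact key (s.sup fun i => (l i).natDegree)
    fun i hi => Finset.le_sup (f := fun i => (l i).natDegree) hi

variable {k : Type*} {V : Type u} [Field k] [AddCommGroup V] [Module k V] [Module k[X] V]
  [IsScalarTower k k[X] V]

/-- Under the hypothesis a k-basis of `W` is independent even over k[X], and a Noetherian module
contains only finite independent families. -/
theorem finiteDimensional_of_coeff [Module.Finite k[X] V] (W : Submodule k V)
    (h : ∀ (ι : Type u) (v : ι → V), (∀ i, v i ∈ W) → ∀ (s : Finset ι) (l : ι → k[X]) (d : ℕ),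
      (∀ i ∈ s, (l i).natDegree ≤ d) →
      ∑ i ∈ s, l i • v i = 0 → ∑ i ∈ s, (l i).coeff d • v i = 0) :
    FiniteDimensional k W := by
  let b := Module.Basis.ofVectorSpace k W
  have hb : LinearIndependent k (fun i => (b i : V)) :=
    b.linearIndependent.map' W.subtype W.ker_subtype
  have hb' : LinearIndependent k[X] (fun i => (b i : V)) :=
    linearIndependent_of_coeff hb (h _ _ fun i => (b i).2)
  have := hb'.finite_of_isNoetherian
  exact Module.Finite.of_basis b

variable [CharZero k] {T : ℕ → V →ₗ[k] V}

/-- The space of vectors of a given nonzero weight has finite dimension. -/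
theorem IsSesqui.finiteDimensional_of_weight [Module.Finite k[X] V] (hT : IsSesqui T)
    {φ : ℕ → k} (hφ : ∃ m, φ m ≠ 0) (W : Submodule k V) (hW : ∀ w ∈ W, ∀ m, T m w = φ m • w) :
    FiniteDimensional k W := by
  classical
  refine finiteDimensional_of_coeff W fun ι v hv s l d hd hl => ?_
  set m := Nat.find hφ
  -- Applying T (m + 1) differentiates a relation; after d differentiations only d! times the
  -- coefficients of degree d remain.
  have hder : ∀ l : ι → k[X], ∑ i ∈ s, l i • v i = 0 →
      ∑ i ∈ s, derivative (l i) • v i = 0 := by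
    intro l hl
    have h1 : ∀ i ∈ s, T (m + 1) (l i • v i) =
        (φ (m + 1) • l i + ((m + 1 : k) * φ m) • derivative (l i)) • v i := by
      intro i _
      have := hT.apply_smul_sub_mem_of_lt (W := ⊥) (u := v i) (φ := φ)
        (fun j => by simp [hW _ (hv i)]) (l i) (m := m)
        (fun j hj => not_not.1 (Nat.find_min hφ hj))
      simpa [sub_eq_zero] using this
    have h2 := congrArg (T (m + 1)) hl
    rw [map_sum, Finset.sum_congr rfl h1, map_zero] at h2
    simp only [add_smul, Finset.sum_add_distrib, smul_assoc] at h2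
    rw [← Finset.smul_sum, ← Finset.smul_sum, hl, smul_zero, zero_add] at h2
    exact (smul_eq_zero.1 h2).resolve_left
      (mul_ne_zero (Nat.cast_add_one_ne_zero m) (Nat.find_spec hφ))
  have hiter : ∀ j : ℕ, ∑ i ∈ s, derivative^[j] (l i) • v i = 0 := by
    intro j
    induction j with
    | zero => exact hl
    | succ j ih => simpa only [Function.iterate_succ_apply'] using hder _ ih
  have h3 := hiter d
  have h4 : ∀ i ∈ s, derivative^[d] (l i) • v i = (d.factorial : k) • ((l i).coeff d • v i) := by
    intro i hi
    rw [iterate_derivative_of_natDegree_le (hd i hi), C_smul_eq, smul_smul]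
  rw [Finset.sum_congr rfl h4, ← Finset.smul_sum] at h3
  exact (smul_eq_zero.1 h3).resolve_left (Nat.cast_ne_zero.2 d.factorial_ne_zero)

end Finiteness

/-! ### Conformal representations and the Lie theorem in weight zero. -/

section Representations

universe u

variable {k L : Type*} {V : Type u} [Field k] [AddCommGroup L] [Module k L] [Module k[X] L]
  [IsScalarTower k k[X] L] [ConformalAlgebra k L]
  [AddCommGroup V] [Module k V] [Module k[X] V] [IsScalarTower k k[X] V]

/-- A representation of a Lie conformal algebra `L` on an `H`-module `V`. -/
structure IsConformalRep (ρ : ℕ → L →ₗ[k] V →ₗ[k] V) : Prop where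
  locality : ∀ x v, ∃ N : ℕ, ∀ n : ℕ, N ≤ n → ρ n x v = 0
  D_left : ∀ (n : ℕ) (x : L) (v : V), ρ n ((X : k[X]) • x) v = -((n : k) • ρ (n - 1) x v)
  sesqui : ∀ x : L, IsSesqui fun n => ρ n x
  jacobi : ∀ (n m : ℕ) (a b : L) (v : V), ρ n a (ρ m b v) - ρ m b (ρ n a v) =
    ∑ s ∈ Finset.range (n + 1), (n.choose s : k) • ρ (m + s) (nprod (k := k) (n - s) a b) v

variable {ρ : ℕ → L →ₗ[k] V →ₗ[k] V}

/-- The elements of `L` all of whose operators have `v` as an eigenvector. -/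
def IsConformalRep.eigenElements (hρ : IsConformalRep ρ) (v : V) : Submodule k[X] L :=
  submoduleOfXSMul
    { carrier := {x : L | ∀ n : ℕ, ∃ c : k, ρ n x v = c • v}
      add_mem' := fun {x y} hx hy n => by
        obtain ⟨c, hc⟩ := hx n
        obtain ⟨d, hd⟩ := hy n
        exact ⟨c + d, by simp [hc, hd, add_smul]⟩
      zero_mem' := fun n => ⟨0, by simp⟩
      smul_mem' := fun r x hx n => by
        obtain ⟨c, hc⟩ := hx n
        exact ⟨r * c, by simp [hc, mul_smul]⟩ }
    (fun x hx n => by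
      obtain ⟨c, hc⟩ := hx (n - 1)
      exact ⟨-(n * c), by rw [hρ.D_left, hc, neg_smul, mul_smul]⟩)

/-- The operators on `V` of the elements of `J`. -/
def operators (ρ : ℕ → L →ₗ[k] V →ₗ[k] V) (J : Submodule k L) : Submodule k (V →ₗ[k] V) :=
  Submodule.span k {A | ∃ a ∈ J, ∃ n : ℕ, A = ρ n a}

theorem mem_operators {J : Submodule k L} {a : L} (ha : a ∈ J) (n : ℕ) :
    ρ n a ∈ operators ρ J := Submodule.subset_span ⟨a, ha, n, rfl⟩

/-- The Jacobi identity writes the commutator through operators of the products of a and b alone. -/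
theorem IsConformalRep.commutator_mem (hρ : IsConformalRep ρ) {J : Submodule k L} {a b : L}
    (h : ∀ n, nprod (k := k) n a b ∈ J) (n m : ℕ) :
    ρ n a ∘ₗ ρ m b - ρ m b ∘ₗ ρ n a ∈ operators ρ J := by
  have : ρ n a ∘ₗ ρ m b - ρ m b ∘ₗ ρ n a = ∑ s ∈ Finset.range (n + 1),
      (n.choose s : k) • ρ (m + s) (nprod (k := k) (n - s) a b) := by
    ext v
    simpa using hρ.jacobi n m a b v
  rw [this]
  exact sum_mem fun s _ => Submodule.smul_mem _ _ (mem_operators (h _) _)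

variable {J : Submodule k L} {M : Submodule k[X] L}

variable [IsAlgClosed k] [CharZero k] [Module.Finite k[X] L] [Module.Finite k[X] V]

/-- The step of the conformal Lie theorem from weight zero. -/
theorem IsConformalRep.exists_eigenvector_of_killed (hρ : IsConformalRep ρ)
    (hMJ : ∀ x ∈ M, ∀ y ∈ M, ∀ n, nprod (k := k) n x y ∈ J) (hJM : ∀ a ∈ J, a ∈ M)
    (h0 : ∃ v : V, v ≠ 0 ∧ ∀ a ∈ J, ∀ n, ρ n a v = 0) :
    ∃ v : V, v ≠ 0 ∧ ∀ x ∈ M, ∀ n, ∃ c : k, ρ n x v = c • v := by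
  classical
  have hop : ∀ v : V, (∀ a ∈ J, ∀ n, ρ n a v = 0) → ∀ A ∈ operators ρ J, A v = 0 := by
    intro v hv A hA
    induction hA using Submodule.span_induction with
    | mem A hA => obtain ⟨a, ha, n, rfl⟩ := hA; exact hv a ha n
    | zero => rfl
    | add A B _ _ hA hB => simp [hA, hB]
    | smul c A _ hA => simp [hA]
  have hcomm : ∀ x ∈ M, ∀ y ∈ M, ∀ n m, ∀ v : V, (∀ a ∈ J, ∀ n, ρ n a v = 0) →
      ρ n x (ρ m y v) = ρ m y (ρ n x v) := fun x hx y hy n m v hv =>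
    sub_eq_zero.1 (hop v hv _ (hρ.commutator_mem (hMJ x hx y hy) n m))
  obtain ⟨G, hG⟩ := (IsNoetherian.noetherian M : M.FG)
  have hGM : ∀ x ∈ G, x ∈ M := fun x hx => hG ▸ Submodule.subset_span hx
  -- Vanishing is tested on generators only: passing from x to Dx shifts the index by one, so a
  -- bound valid for all of M need not exist.
  let W : ℕ → Submodule k V := fun n =>
    { carrier := {v | (∀ a ∈ J, ∀ j, ρ j a v = 0) ∧ ∀ x ∈ G, ∀ m ≥ n, ρ m x v = 0}
      add_mem' := fun {u v} hu hv =>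
        ⟨fun a ha j => by rw [map_add, hu.1 a ha j, hv.1 a ha j, add_zero],
          fun x hx m hm => by rw [map_add, hu.2 x hx m hm, hv.2 x hx m hm, add_zero]⟩
      zero_mem' := ⟨fun a _ j => map_zero _, fun x _ m _ => map_zero _⟩
      smul_mem' := fun c v hv =>
        ⟨fun a ha j => by rw [map_smul, hv.1 a ha j, smul_zero],
          fun x hx m hm => by rw [map_smul, hv.2 x hx m hm, smul_zero]⟩ }
  have hW : ∃ n, W n ≠ ⊥ := by
    obtain ⟨v, hv0, hv⟩ := h0
    choose N hN using fun x => hρ.locality x v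
    refine ⟨G.sup N, fun h => hv0 ?_⟩
    have : v ∈ W (G.sup N) := ⟨hv, fun x hx m hm => hN x m ((Finset.le_sup hx).trans hm)⟩
    simpa [h] using this
  obtain ⟨n, hn, hmin⟩ : ∃ n, W n ≠ ⊥ ∧ ∀ j < n, W j = ⊥ :=
    ⟨Nat.find hW, Nat.find_spec hW, fun j hj => not_not.1 (Nat.find_min hW hj)⟩
  cases n with
  | zero =>
    obtain ⟨v, hv, hv0⟩ := Submodule.exists_mem_ne_zero_of_ne_bot hn
    refine ⟨v, hv0, fun x hx => ?_⟩
    have hle : M ≤ hρ.eigenElements v := by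
      rw [← hG, Submodule.span_le]
      exact fun y hy j => ⟨0, by rw [hv.2 y hy j (Nat.zero_le j), zero_smul]⟩
    exact hle hx
  | succ n =>
    have hbot := hmin n (Nat.lt_succ_self n)
    have : FiniteDimensional k (W (n + 1)) := by
      refine finiteDimensional_of_coeff _ fun ι v hv s l d hd hl => ?_
      have hmem : ∑ i ∈ s, (l i).coeff d • v i ∈ W (n + 1) :=
        sum_mem fun i _ => Submodule.smul_mem _ _ (hv i)
      suffices ∑ i ∈ s, (l i).coeff d • v i ∈ W n by simpa [hbot] using this
      refine ⟨hmem.1, fun x hx m hm => ?_⟩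
      rcases hm.lt_or_eq with hm | rfl
      · exact hmem.2 x hx m hm
      -- At index n + d the Taylor terms of order below d involve indices above n, which vanish on W
      -- (n + 1), and those of order above d have zero derivative. The remaining term puts the sum
      -- of leading terms in W n, which is zero by minimality.
      have h1 : ∀ i ∈ s, ρ (n + d) x (l i • v i) =
          (((n + d).choose d : k) * d.factorial) • ρ n x ((l i).coeff d • v i) := by
        intro i hi
        rw [(hρ.sesqui x).apply_smul, Finset.sum_eq_single d]
        · rw [iterate_derivative_of_natDegree_le (hd i hi), C_smul_eq, map_smul, smul_smul,
            smul_smul, Nat.add_sub_cancel, mul_assoc]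
        · intro j _ hj
          rcases hj.lt_or_gt with hj | hj
          · rw [(hv i).2 x hx _ (by omega), smul_zero, smul_zero]
          · rw [iterate_derivative_eq_zero ((hd i hi).trans_lt hj), zero_smul, smul_zero]
        · intro h
          exact absurd (Finset.mem_range.2 (by omega)) h
      have h2 := congrArg (ρ (n + d) x) hl
      rw [map_sum, Finset.sum_congr rfl h1, map_zero, ← Finset.smul_sum, ← map_sum] at h2
      exact (smul_eq_zero.1 h2).resolve_left (mul_ne_zero
        (Nat.cast_ne_zero.2 (Nat.choose_pos (Nat.le_add_left d n)).ne')
        (Nat.cast_ne_zero.2 d.factorial_ne_zero))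
    obtain ⟨v, -, hv0, hv⟩ := exists_common_eigenvector {A | ∃ x ∈ M, ∃ m, A = ρ m x}
      (W (n + 1)) hn
      (by
        rintro A ⟨x, hx, m, rfl⟩ w hw
        refine ⟨fun a ha j => ?_, fun y hy j hj => ?_⟩
        · rw [hcomm a (hJM a ha) x hx j m w hw.1, hw.1 a ha, map_zero]
        · rw [hcomm y (hGM y hy) x hx j m w hw.1, hw.2 y hy j hj, map_zero])
      (by
        rintro A ⟨x, hx, m, rfl⟩ B ⟨y, hy, j, rfl⟩
        refine ⟨0, fun w hw => ?_⟩
        rw [hcomm x hx y hy m j w hw.1, sub_self, zero_smul])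
    exact ⟨v, hv0, fun x hx m => hv _ ⟨x, hx, m, rfl⟩⟩

end Representations

/-! ### Weights of commutators along the iterates of an operator. -/

section Shift

variable {k V : Type*} [Field k] [AddCommGroup V] [Module k V]

theorem iterate_mem_span {A : V →ₗ[k] V} {v w : V} {p : ℕ}
    (hw : w ∈ Submodule.span k ((fun i => A^[i] v) '' Set.Iio p)) :
    A w ∈ Submodule.span k ((fun i => A^[i] v) '' Set.Iio (p + 1)) := by
  induction hw using Submodule.span_induction with
  | mem w hw =>
    obtain ⟨i, hi, rfl⟩ := hw
    exact Submodule.subset_span ⟨i + 1, Nat.succ_lt_succ hi, Function.iterate_succ_apply' _ _ _⟩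
  | zero => simp
  | add u w _ _ hu hw => rw [map_add]; exact add_mem hu hw
  | smul c w _ hw => rw [map_smul]; exact Submodule.smul_mem _ c hw

variable {O : Submodule k (V →ₗ[k] V)} {A : V →ₗ[k] V} {v : V} {χ : (V →ₗ[k] V) → k}

/-- A space of operators normalized by `A` acts triangularly on the iterates of `A` at a weight
vector. -/
theorem apply_iterate_sub_mem (hA : ∀ T ∈ O, T ∘ₗ A - A ∘ₗ T ∈ O)
    (hχ : ∀ T ∈ O, T v = χ T • v) {T : V →ₗ[k] V} (hT : T ∈ O) (j : ℕ) :
    T (A^[j] v) - χ T • A^[j] v ∈ Submodule.span k ((fun i => A^[i] v) '' Set.Iio j) := by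
  induction j generalizing T with
  | zero => simp [hχ T hT]
  | succ j ih =>
    have e : T (A^[j + 1] v) - χ T • A^[j + 1] v =
        A (T (A^[j] v) - χ T • A^[j] v) +
          ((T ∘ₗ A - A ∘ₗ T) (A^[j] v) - χ (T ∘ₗ A - A ∘ₗ T) • A^[j] v) +
          χ (T ∘ₗ A - A ∘ₗ T) • A^[j] v := by
      simp only [Function.iterate_succ_apply', LinearMap.sub_apply, LinearMap.comp_apply, map_sub,
        map_smul]
      abel
    rw [e]
    refine add_mem (add_mem (iterate_mem_span (ih hT)) ?_) ?_
    · exact Submodule.span_mono (Set.image_mono (Set.Iio_subset_Iio (Nat.le_succ j)))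
        (ih (hA T hT))
    · exact Submodule.smul_mem _ _ (Submodule.subset_span ⟨j, Nat.lt_succ_self j, rfl⟩)

/-- Moving T past each of the j + 1 factors A produces one commutator, and each contributes the same
weight to the next lower iterate. -/
theorem apply_iterate_succ_sub_mem (hA : ∀ T ∈ O, T ∘ₗ A - A ∘ₗ T ∈ O)
    (hχ : ∀ T ∈ O, T v = χ T • v) {T : V →ₗ[k] V} (hT : T ∈ O) (j : ℕ) :
    T (A^[j + 1] v) - χ T • A^[j + 1] v - ((j + 1 : k) * χ (T ∘ₗ A - A ∘ₗ T)) • A^[j] v ∈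
      Submodule.span k ((fun i => A^[i] v) '' Set.Iio j) := by
  induction j with
  | zero =>
    have h := hχ _ (hA T hT)
    simp only [LinearMap.sub_apply, LinearMap.comp_apply, hχ T hT, map_smul] at h
    simp [h]
  | succ j ih =>
    have e : T (A^[j + 1 + 1] v) - χ T • A^[j + 1 + 1] v -
          (((j + 1 : ℕ) + 1 : k) * χ (T ∘ₗ A - A ∘ₗ T)) • A^[j + 1] v =
        A (T (A^[j + 1] v) - χ T • A^[j + 1] v -
          ((j + 1 : k) * χ (T ∘ₗ A - A ∘ₗ T)) • A^[j] v) +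
          ((T ∘ₗ A - A ∘ₗ T) (A^[j + 1] v) - χ (T ∘ₗ A - A ∘ₗ T) • A^[j + 1] v) := by
      have h1 : A^[j + 1 + 1] v = A (A^[j + 1] v) := Function.iterate_succ_apply' _ _ _
      have h2 : A (A^[j] v) = A^[j + 1] v := (Function.iterate_succ_apply' _ _ _).symm
      rw [h1, map_sub, map_sub, map_smul, map_smul, h2, LinearMap.sub_apply, LinearMap.comp_apply,
        LinearMap.comp_apply]
      push_cast
      module
    rw [e]
    exact add_mem (iterate_mem_span ih) (apply_iterate_sub_mem hA hχ (hA T hT) (j + 1))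

variable [Module k[X] V] [IsScalarTower k k[X] V] [CharZero k] [Module.Finite k[X] V]

/-- The weights of the commutators with `A` are proportional to the shift of the weights caused
by `D`. -/
theorem exists_shift (hA : ∀ T ∈ O, T ∘ₗ A - A ∘ₗ T ∈ O) (hχ : ∀ T ∈ O, T v = χ T • v)
    (hv : v ≠ 0) (T₀ : ℕ → V →ₗ[k] V) (hT₀ : IsSesqui T₀) (hT₀O : ∀ m, T₀ m ∈ O)
    (hT₀χ : ∃ m, χ (T₀ m) ≠ 0) :
    ∃ c : k, ∀ T : ℕ → V →ₗ[k] V, IsSesqui T → (∀ m, T m ∈ O) →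
      ∀ m, χ (T m ∘ₗ A - A ∘ₗ T m) = c * m * χ (T (m - 1)) := by
  classical
  set e : ℕ → V := fun i => A^[i] v with he
  let W : ℕ →o Submodule k[X] V :=
    ⟨fun p => Submodule.span k[X] (e '' Set.Iio p),
      fun p q h => Submodule.span_mono (Set.image_mono (Set.Iio_subset_Iio h))⟩
  have hUW : ∀ p, ∀ w ∈ Submodule.span k (e '' Set.Iio p), w ∈ W p := by
    intro p w hw
    have : Submodule.span k (e '' Set.Iio p) ≤ (W p).restrictScalars k :=
      Submodule.span_le.2 Submodule.subset_span
    exact this hw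
  have hex : ∃ q, e q ∈ W q := by
    obtain ⟨n, hn⟩ := monotone_stabilizes_iff_noetherian.2
      (inferInstance : IsNoetherian k[X] V) W
    exact ⟨n, by rw [hn (n + 1) (Nat.le_succ n)]
                 exact Submodule.subset_span ⟨n, Nat.lt_succ_self n, rfl⟩⟩
  -- For the least q = p + 1, the vector e p is outside W p while e (p + 1) is h • e p modulo W p.
  -- Computing T m (h • e p) both by the triangular action on iterates and by Taylor expansion gives
  -- the claim.
  obtain ⟨q, hq, hmin⟩ : ∃ q, e q ∈ W q ∧ ∀ j < q, e j ∉ W j :=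
    ⟨Nat.find hex, Nat.find_spec hex, fun j hj => Nat.find_min hex hj⟩
  cases q with
  | zero => exact absurd (by simpa [W, e] using hq) hv
  | succ p =>
  have hu : e p ∉ W p := hmin p (Nat.lt_succ_self p)
  obtain ⟨h, w, hw, hy⟩ : ∃ h : k[X], ∃ w ∈ W p, e (p + 1) = h • e p + w := by
    have hs : e '' Set.Iio (p + 1) = insert (e p) (e '' Set.Iio p) := by
      rw [← Set.image_insert_eq]
      congr 1
      ext i
      simp
    have : e (p + 1) ∈ Submodule.span k[X] (e '' Set.Iio (p + 1)) := hq
    rw [hs] at this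
    exact Submodule.mem_span_insert.1 this
  have hstab : ∀ T : ℕ → V →ₗ[k] V, IsSesqui T → (∀ m, T m ∈ O) →
      ∀ m, ∀ w ∈ W p, T m w ∈ W p := by
    intro T hT hTO m w hw
    refine hT.map_span_mem ?_ hw m
    rintro _ ⟨i, hi, rfl⟩ j
    have h1 := W.monotone (le_of_lt hi) (hUW _ _ (apply_iterate_sub_mem hA hχ (hTO j) i))
    have h2 : χ (T j) • e i ∈ W p := smul_mem_of_field _ _ (Submodule.subset_span ⟨i, hi, rfl⟩)
    simpa [he] using add_mem h1 h2
  have hwt : ∀ T : ℕ → V →ₗ[k] V, (∀ m, T m ∈ O) →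
      ∀ m, T m (e p) - χ (T m) • e p ∈ W p := fun T hTO m =>
    hUW _ _ (apply_iterate_sub_mem hA hχ (hTO m) p)
  have hE : ∀ T : ℕ → V →ₗ[k] V, IsSesqui T → (∀ m, T m ∈ O) → ∀ m,
      T m (h • e p) - (χ (T m) • h + C ((p + 1 : k) * χ (T m ∘ₗ A - A ∘ₗ T m))) • e p ∈ W p := by
    intro T hT hTO m
    have h1 := hUW _ _ (apply_iterate_succ_sub_mem hA hχ (hTO m) p)
    change T m (e (p + 1)) - χ (T m) • e (p + 1) - _ • e p ∈ W p at h1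
    rw [hy, map_add] at h1
    have h2 := sub_mem h1 (sub_mem (hstab T hT hTO m w hw) (smul_mem_of_field _ (χ (T m)) hw))
    convert h2 using 1
    rw [add_smul, C_smul_eq, smul_assoc, smul_add]
    abel
  -- Just past the lowest nonzero weight of T₀, the two computations differ by a nonzero multiple of
  -- h' minus a constant, applied to e p; since e p is not torsion modulo W p, h' is constant.
  obtain ⟨c₀, hc₀⟩ : ∃ c₀ : k, derivative h = C c₀ := by
    set m := Nat.find hT₀χ
    have h1 := hT₀.apply_smul_sub_mem_of_lt (hwt T₀ hT₀O) h (m := m)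
      (fun j hj => not_not.1 (Nat.find_min hT₀χ hj))
    have h2 := sub_mem (hE T₀ hT₀ hT₀O (m + 1)) h1
    rw [sub_sub_sub_cancel_left, ← sub_smul, add_sub_add_left_eq_sub] at h2
    have h3 := hT₀.eq_zero_of_smul_mem (hstab T₀ hT₀ hT₀O) (hwt T₀ hT₀O) hT₀χ hu _ h2
    have hne : ((m + 1 : k) * χ (T₀ m)) ≠ 0 :=
      mul_ne_zero (Nat.cast_add_one_ne_zero m) (Nat.find_spec hT₀χ)
    rw [sub_eq_zero] at h3
    refine ⟨((m + 1 : k) * χ (T₀ m))⁻¹ *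
      ((p + 1 : k) * χ (T₀ (m + 1) ∘ₗ A - A ∘ₗ T₀ (m + 1))), ?_⟩
    rw [C_mul, ← h3, ← smul_eq_C_mul, smul_smul, inv_mul_cancel₀ hne, one_smul]
  refine ⟨(p + 1 : k)⁻¹ * c₀, fun T hT hTO m => ?_⟩
  have h1 := hT.apply_smul_sub_mem (hwt T hTO) h m
  have hsum : ∑ i ∈ Finset.range (m + 1), (m.choose i * χ (T (m - i)) : k) • derivative^[i] h =
      χ (T m) • h + C (m * χ (T (m - 1)) * c₀) := by
    cases m with
    | zero => simp
    | succ m =>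
      rw [Finset.sum_range_succ', Finset.sum_range_succ', Finset.sum_eq_zero]
      · simp [hc₀, smul_eq_C_mul, add_comm]
      · intro i _
        rw [Function.iterate_succ_apply, Function.iterate_succ_apply, hc₀, derivative_C,
          iterate_derivative_zero, smul_zero]
  rw [hsum] at h1
  have h2 := sub_mem (hE T hT hTO m) h1
  rw [sub_sub_sub_cancel_left, ← sub_smul, add_sub_add_left_eq_sub, ← C_sub, C_smul_eq] at h2
  have h3 : (m * χ (T (m - 1)) * c₀ - (p + 1 : k) * χ (T m ∘ₗ A - A ∘ₗ T m)) = 0 := by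
    by_contra hne
    have := smul_mem_of_field _ (m * χ (T (m - 1)) * c₀ -
      (p + 1 : k) * χ (T m ∘ₗ A - A ∘ₗ T m))⁻¹ h2
    rw [smul_smul, inv_mul_cancel₀ hne, one_smul] at this
    exact hu this
  have hp : (p + 1 : k) ≠ 0 := Nat.cast_add_one_ne_zero p
  field_simp
  linear_combination -h3

end Shift

/-! ### The inductive step of the Lie theorem for arbitrary weights. -/

section Representations

universe u

variable {k L : Type*} {V : Type u} [Field k] [AddCommGroup L] [Module k L] [Module k[X] L]
  [IsScalarTower k k[X] L] [ConformalAlgebra k L]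
  [AddCommGroup V] [Module k V] [Module k[X] V] [IsScalarTower k k[X] V]
  {ρ : ℕ → L →ₗ[k] V →ₗ[k] V} {J : Submodule k L} {M : Submodule k[X] L}
  [IsAlgClosed k] [CharZero k] [Module.Finite k[X] L] [Module.Finite k[X] V]

/-- The step of the conformal Lie theorem. -/
theorem IsConformalRep.exists_eigenvector_step (hρ : IsConformalRep ρ)
    (hMJ : ∀ x ∈ M, ∀ y ∈ M, ∀ n, nprod (k := k) n x y ∈ J) (hJM : ∀ a ∈ J, a ∈ M)
    (h0 : ∃ v : V, v ≠ 0 ∧ ∀ a ∈ J, ∀ n, ∃ c : k, ρ n a v = c • v) :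
    ∃ v : V, v ≠ 0 ∧ ∀ x ∈ M, ∀ n, ∃ c : k, ρ n x v = c • v := by
  classical
  obtain ⟨v, hv0, hv⟩ := h0
  choose! φ hφ using hv
  by_cases hzero : ∀ a ∈ J, ∀ n, φ a n = 0
  · exact hρ.exists_eigenvector_of_killed hMJ hJM
      ⟨v, hv0, fun a ha n => by rw [hφ a ha n, hzero a ha n, zero_smul]⟩
  push Not at hzero
  obtain ⟨a₀, ha₀, m₁, hm₁⟩ := hzero
  let W : Submodule k V :=
    { carrier := {w | ∀ a ∈ J, ∀ n, ρ n a w = φ a n • w}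
      add_mem' := fun {u w} hu hw a ha n => by rw [map_add, hu a ha n, hw a ha n, smul_add]
      zero_mem' := fun a _ n => by rw [map_zero, smul_zero]
      smul_mem' := fun c w hw a ha n => by rw [map_smul, hw a ha n, smul_comm] }
  have hvW : v ∈ W := hφ
  have : FiniteDimensional k W := (hρ.sesqui a₀).finiteDimensional_of_weight ⟨m₁, hm₁⟩ W
    fun w hw m => hw a₀ ha₀ m
  have hχex : ∀ A ∈ operators ρ J, ∃ c : k, ∀ w ∈ W, A w = c • w := by
    intro A hA
    induction hA using Submodule.span_induction with
    | mem A hA => obtain ⟨a, ha, n, rfl⟩ := hA; exact ⟨φ a n, fun w hw => hw a ha n⟩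
    | zero => exact ⟨0, by simp⟩
    | add A B _ _ hA hB =>
      obtain ⟨c, hc⟩ := hA
      obtain ⟨d, hd⟩ := hB
      exact ⟨c + d, fun w hw => by rw [LinearMap.add_apply, hc w hw, hd w hw, add_smul]⟩
    | smul r A _ hA =>
      obtain ⟨c, hc⟩ := hA
      exact ⟨r * c, fun w hw => by rw [LinearMap.smul_apply, hc w hw, mul_smul]⟩
  choose! χ hχ using hχex
  have hχφ : ∀ a ∈ J, ∀ n, χ (ρ n a) = φ a n := fun a ha n =>
    smul_left_injective k hv0 ((hχ _ (mem_operators ha n) v hvW).symm.trans (hφ a ha n))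
  have hD : ∀ w ∈ W, (X : k[X]) • w ∈ W → w = 0 := by
    intro w hw hDw
    have h := hρ.sesqui a₀ (m₁ + 1) w
    simp only [Nat.add_sub_cancel] at h
    rw [hDw a₀ ha₀, hw a₀ ha₀, hw a₀ ha₀, smul_comm (X : k[X]) (φ a₀ (m₁ + 1)) w, left_eq_add,
      smul_smul] at h
    exact (smul_eq_zero.1 h).resolve_left
      (mul_ne_zero (Nat.cast_ne_zero.2 (Nat.succ_ne_zero m₁)) hm₁)
  have hnorm : ∀ x ∈ M, ∀ n, ∀ A ∈ operators ρ J, A ∘ₗ ρ n x - ρ n x ∘ₗ A ∈ operators ρ J := by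
    intro x hx n A hA
    induction hA using Submodule.span_induction with
    | mem A hA =>
      obtain ⟨a, ha, m, rfl⟩ := hA
      exact hρ.commutator_mem (fun j => hMJ a (hJM a ha) x hx j) m n
    | zero => simp
    | add A B _ _ hA hB =>
      rw [LinearMap.add_comp, LinearMap.comp_add, add_sub_add_comm]
      exact add_mem hA hB
    | smul r A _ hA =>
      rw [LinearMap.smul_comp, LinearMap.comp_smul, ← smul_sub]
      exact Submodule.smul_mem _ _ hA
  -- On W the operators of J have the same commutators with ρ n x as with cD, so the difference maps
  -- W to itself.
  have hshift : ∀ x ∈ M, ∀ n, ∃ c : k, ∀ w ∈ W, ρ n x w - c • (X : k[X]) • w ∈ W := by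
    intro x hx n
    obtain ⟨c, hc⟩ := exists_shift (hnorm x hx n) (fun T hT => hχ T hT v hvW) hv0
      (fun m => ρ m a₀) (hρ.sesqui a₀) (fun m => mem_operators ha₀ m)
      ⟨m₁, by rwa [hχφ a₀ ha₀]⟩
    refine ⟨c, fun w hw a ha m => ?_⟩
    have h1 := hχ _ (hnorm x hx n _ (mem_operators ha m)) w hw
    rw [hc (fun m => ρ m a) (hρ.sesqui a) (fun m => mem_operators ha m) m, hχφ a ha,
      LinearMap.sub_apply, LinearMap.comp_apply, LinearMap.comp_apply, hw a ha, map_smul,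
      sub_eq_iff_eq_add] at h1
    have h2 := hρ.sesqui a m w
    simp only at h2
    rw [map_sub, map_smul, h1, h2, hw a ha, hw a ha, smul_comm (X : k[X]) (φ a m) w]
    module
  have hstab : ∀ x ∈ M, ∀ n, ∀ w ∈ W, ρ n x w ∈ W := by
    intro x hx
    obtain ⟨N, hN⟩ := hρ.locality x v
    have hc0 : ∀ c : k, c • (X : k[X]) • v ∈ W → c = 0 := by
      intro c hc
      by_contra hne
      have := W.smul_mem c⁻¹ hc
      rw [smul_smul, inv_mul_cancel₀ hne, one_smul] at this
      exact hv0 (hD v hvW this)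
    -- Descent on n: from N on, ρ n x kills v, so cDv lies in W and c = 0.
    have key : ∀ d n, N ≤ n + d → ∀ w ∈ W, ρ n x w ∈ W := by
      intro d
      induction d with
      | zero =>
        intro n hn
        obtain ⟨c, hc⟩ := hshift x hx n
        have h1 := hc v hvW
        rw [hN n hn, zero_sub, Submodule.neg_mem_iff] at h1
        simpa [hc0 c h1] using hc
      | succ d ih =>
        intro n hn
        have hY := ih (n + 1) (by omega)
        obtain ⟨c, hc⟩ := hshift x hx n
        have h1 := hχ _ (hρ.commutator_mem (fun j => hMJ x hx x hx j) n (n + 1)) v hvW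
        have h2 := hρ.sesqui x (n + 1) v
        simp only [Nat.add_sub_cancel] at h2
        have h3 := hY _ (hc v hvW)
        rw [map_sub, map_smul, h2] at h3
        have h4 := hc _ (hY v hvW)
        have h5 : ρ n x (ρ (n + 1) x v) - ρ (n + 1) x (ρ n x v) ∈ W := by
          rw [LinearMap.sub_apply, LinearMap.comp_apply, LinearMap.comp_apply] at h1
          rw [h1]
          exact W.smul_mem _ hvW
        -- The commutator of ρ n x and ρ (n + 1) x is a scalar on v. Modulo W it equals that of cD
        -- and ρ (n + 1) x, which is -c(n + 1) ρ n x, and ρ n x v is again cDv modulo W.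
        have h6 : (c * (c * ((n + 1 : ℕ) : k))) • (X : k[X]) • v ∈ W := by
          have h7 := sub_mem (sub_mem (sub_mem h4 h5) h3)
            (W.smul_mem (c * ((n + 1 : ℕ) : k)) (hc v hvW))
          convert h7 using 1
          module
        have h8 : c = 0 := by
          have := hc0 _ h6
          have hn1 : ((n + 1 : ℕ) : k) ≠ 0 := Nat.cast_ne_zero.2 (Nat.succ_ne_zero n)
          simpa [-Nat.cast_add, hn1] using this
        simpa [h8] using hc
    exact fun n => key N n (Nat.le_add_left N n)
  obtain ⟨u, -, hu0, hu⟩ := exists_common_eigenvector {A | ∃ x ∈ M, ∃ m, A = ρ m x} W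
    (fun h => hv0 (by simpa [h] using hvW))
    (by rintro A ⟨x, hx, m, rfl⟩ w hw; exact hstab x hx m w hw)
    (by
      rintro A ⟨x, hx, m, rfl⟩ B ⟨y, hy, j, rfl⟩
      exact ⟨_, hχ _ (hρ.commutator_mem (fun i => hMJ x hx y hy i) m j)⟩)
  exact ⟨u, hu0, fun x hx m => hu _ ⟨x, hx, m, rfl⟩⟩

end Representations

/-! ### The derived series and the conformal Lie theorem. -/

section Solvable

universe u

variable {k L : Type*} {V : Type u} [Field k] [AddCommGroup L] [Module k L] [Module k[X] L]
  [IsScalarTower k k[X] L] [ConformalAlgebra k L]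

/-- D applied to a product is the product with Dy minus a multiple of the preceding product, and
both lie in the same term. -/
theorem X_smul_mem_derivedSeries (i : ℕ) :
    ∀ x ∈ derivedSeries k L i, (X : k[X]) • x ∈ derivedSeries k L i := by
  induction i with
  | zero => exact fun x _ => Submodule.mem_top
  | succ i ih =>
    intro z hz
    change z ∈ Submodule.span k _ at hz
    induction hz using Submodule.span_induction with
    | mem z hz =>
      obtain ⟨x, hx, y, hy, n, rfl⟩ := hz
      have h1 : nprod (k := k) n x ((X : k[X]) • y) ∈ derivedSeries k L (i + 1) :=
        Submodule.subset_span ⟨x, hx, _, ih y hy, n, rfl⟩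
      have h2 : nprod (k := k) (n - 1) x y ∈ derivedSeries k L (i + 1) :=
        Submodule.subset_span ⟨x, hx, y, hy, n - 1, rfl⟩
      rw [nprod_D] at h1
      exact (Submodule.add_mem_iff_left _ (Submodule.smul_mem _ _ h2)).1 h1
    | zero => rw [smul_zero]; exact zero_mem _
    | add x y _ _ hx hy => rw [smul_add]; exact add_mem hx hy
    | smul c x _ hx => rw [smul_comm]; exact Submodule.smul_mem _ _ hx

theorem derivedSeries_succ_le (i : ℕ) : derivedSeries k L (i + 1) ≤ derivedSeries k L i := by
  induction i with
  | zero => exact le_top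
  | succ i ih =>
    refine Submodule.span_mono ?_
    rintro z ⟨x, hx, y, hy, n, rfl⟩
    exact ⟨x, ih hx, y, ih hy, n, rfl⟩

variable [AddCommGroup V] [Module k V] [Module k[X] V] [IsScalarTower k k[X] V]
  {ρ : ℕ → L →ₗ[k] V →ₗ[k] V}

/-- The conformal Lie theorem: a solvable Lie conformal algebra has a common eigenvector in every
nonzero finite representation. -/
theorem IsConformalRep.exists_eigenvector [IsAlgClosed k] [CharZero k] [Module.Finite k[X] L]
    [Module.Finite k[X] V] [Nontrivial V] (hρ : IsConformalRep ρ) (hs : IsSolvable k L) :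
    ∃ v : V, v ≠ 0 ∧ ∀ x n, ∃ c : k, ρ n x v = c • v := by
  obtain ⟨N, hN⟩ := hs
  have key : ∀ j i, i + j = N → ∃ v : V, v ≠ 0 ∧ ∀ x ∈ derivedSeries k L i, ∀ n,
      ∃ c : k, ρ n x v = c • v := by
    intro j
    induction j with
    | zero =>
      rintro i rfl
      obtain ⟨v, hv⟩ := exists_ne (0 : V)
      refine ⟨v, hv, fun x hx n => ⟨0, ?_⟩⟩
      rw [Nat.add_zero] at hN
      rw [hN, Submodule.mem_bot] at hx
      simp [hx]
    | succ j ih =>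
      intro i hi
      exact hρ.exists_eigenvector_step (J := derivedSeries k L (i + 1))
        (M := submoduleOfXSMul _ (X_smul_mem_derivedSeries i))
        (fun x hx y hy n => Submodule.subset_span ⟨x, hx, y, hy, n, rfl⟩)
        (fun a ha => derivedSeries_succ_le i ha) (ih (i + 1) (by omega))
  obtain ⟨v, hv0, hv⟩ := key N 0 (Nat.zero_add N)
  exact ⟨v, hv0, fun x => hv x Submodule.mem_top⟩

end Solvable

/-! ### Saturation of a weight vector. -/

/-- Every nonzero vector of a finite torsion-free module over a principal ideal domain is a
multiple of a vector spanning a saturated submodule. -/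
theorem exists_saturated_generator {R V : Type*} [CommRing R] [IsDomain R]
    [IsPrincipalIdealRing R] [AddCommGroup V] [Module R V] [Module.Finite R V]
    [Module.IsTorsionFree R V] {v : V} (hv : v ≠ 0) :
    ∃ (w : V) (p : R), v = p • w ∧
      ∀ (h : R) (s : V), h ≠ 0 → h • s ∈ Submodule.span R {w} → s ∈ Submodule.span R {w} := by
  let S : Submodule R V :=
    { carrier := {s | ∃ h : R, h ≠ 0 ∧ ∃ g : R, h • s = g • v}
      add_mem' := by
        rintro s t ⟨h, hh, g, hs⟩ ⟨h', hh', g', ht⟩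
        refine ⟨h * h', mul_ne_zero hh hh', h' * g + h * g', ?_⟩
        rw [smul_add, add_smul, mul_comm h h', mul_smul, hs, mul_comm h' h, mul_smul, ht, mul_smul,
          mul_smul]
      zero_mem' := ⟨1, one_ne_zero, 0, by simp⟩
      smul_mem' := by
        rintro c s ⟨h, hh, g, hs⟩
        exact ⟨h, hh, c * g, by rw [smul_comm, hs, mul_smul]⟩ }
  -- S, the saturation of the line of v, is free; any two of its elements are dependent, so its rank
  -- is one.
  obtain ⟨n, b⟩ := Submodule.basisOfPid (Module.finBasis R V) S
  have hn : ∀ i j : Fin n, i = j := by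
    intro i j
    by_contra hij
    obtain ⟨h, hh, g, hs⟩ := (b i).2
    obtain ⟨h', hh', g', ht⟩ := (b j).2
    have h1 : (g' * h) • b i - (g * h') • b j = 0 := by
      apply Subtype.ext
      push_cast
      rw [mul_smul, mul_smul, hs, ht, smul_comm, sub_self]
    have h2 := congrArg (fun z => b.repr z i) h1
    simp [Ne.symm hij, hh] at h2
    rw [h2, zero_smul] at ht
    have := b.ne_zero j
    exact this (Subtype.ext ((smul_eq_zero.1 ht).resolve_left hh'))
  have hvS : v ∈ S := ⟨1, one_ne_zero, 1, rfl⟩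
  have hpos : 0 < n := by
    by_contra h0
    obtain rfl : n = 0 := by omega
    have := b.ext_elem (x := ⟨v, hvS⟩) (y := 0) fun i => i.elim0
    exact hv (congrArg Subtype.val this)
  have hgen : ∀ s ∈ S, ∃ p : R, s = p • (b ⟨0, hpos⟩ : V) := by
    intro s hs
    refine ⟨b.repr ⟨s, hs⟩ ⟨0, hpos⟩, ?_⟩
    have h1 := b.sum_repr ⟨s, hs⟩
    rw [Finset.sum_eq_single ⟨0, hpos⟩ (fun j _ hj => absurd (hn _ _) hj) (by simp)] at h1
    exact (congrArg Subtype.val h1).symm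
  obtain ⟨p, hp⟩ := hgen v hvS
  refine ⟨b ⟨0, hpos⟩, p, hp, fun h s hh hs => ?_⟩
  obtain ⟨c, hc⟩ := Submodule.mem_span_singleton.1 hs
  obtain ⟨h', hh', g, hg⟩ := (b ⟨0, hpos⟩).2
  have hsS : s ∈ S := ⟨h' * h, mul_ne_zero hh' hh, c * g, by
    rw [mul_smul, ← hc, smul_comm, hg, mul_smul]⟩
  obtain ⟨q, hq⟩ := hgen s hsS
  exact Submodule.mem_span_singleton.2 ⟨q, hq.symm⟩

theorem degree_iterate_derivative_succ_lt {R : Type*} [CommSemiring R] {p : R[X]} (hp : p ≠ 0)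
    (i : ℕ) : (derivative^[i + 1] p).degree < p.degree := by
  induction i with
  | zero => exact degree_derivative_lt hp
  | succ i ih =>
    rw [Function.iterate_succ_apply']
    exact (degree_derivative_le).trans_lt ih

section Saturation

variable {k V : Type*} [Field k] [AddCommGroup V] [Module k V] [Module k[X] V]
  [IsScalarTower k k[X] V]

/-- A generator of the saturation of a weight vector is a weight vector. -/
theorem IsSesqui.weight_of_saturated [Module.IsTorsionFree k[X] V] {T : ℕ → V →ₗ[k] V}
    (hT : IsSesqui T) {w : V} (hw : w ≠ 0) {p : k[X]} (hp : p ≠ 0) {φ : ℕ → k}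
    (hφ : ∀ m, T m (p • w) = φ m • p • w)
    (hsat : ∀ (h : k[X]) (s : V), h ≠ 0 → h • s ∈ Submodule.span k[X] {w} →
      s ∈ Submodule.span k[X] {w}) (m : ℕ) : T m w = φ m • w := by
  induction m using Nat.strong_induction_on with
  | _ m ih =>
    have h1 := hφ m
    rw [hT.apply_smul, Finset.sum_range_succ'] at h1
    set q : k[X] := ∑ i ∈ Finset.range m, (m.choose (i + 1) * φ (m - (i + 1)) : k) •
      derivative^[i + 1] p with hq
    have h2 : ∑ i ∈ Finset.range m, (m.choose (i + 1) : k) •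
        (derivative^[i + 1] p • T (m - (i + 1)) w) = q • w := by
      rw [hq, Finset.sum_smul]
      refine Finset.sum_congr rfl fun i hi => ?_
      have := Finset.mem_range.1 hi
      rw [ih (m - (i + 1)) (by omega), smul_assoc, mul_smul, smul_comm (derivative^[i + 1] p)]
    have hqdeg : q.degree < p.degree := by
      refine (degree_sum_le _ _).trans_lt ?_
      rw [Finset.sup_lt_iff (bot_lt_iff_ne_bot.2 (degree_eq_bot.not.2 hp))]
      exact fun i _ => (degree_smul_le _ _).trans_lt (degree_iterate_derivative_succ_lt hp i)
    rw [h2] at h1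
    simp only [Nat.choose_zero_right, Nat.cast_one, Function.iterate_zero, id, Nat.sub_zero,
      one_smul] at h1
    have h3 : p • T m w = (φ m • p - q) • w := by
      rw [sub_smul, smul_assoc, ← h1, add_sub_cancel_left]
    obtain ⟨f, hf⟩ := Submodule.mem_span_singleton.1 (hsat p (T m w) hp (by
      rw [h3]; exact Submodule.smul_mem _ _ (Submodule.mem_span_singleton_self w)))
    rw [← hf, smul_smul] at h3
    have h4 : p * f = φ m • p - q := smul_left_injective k[X] hw h3
    -- q gathers derivatives of p and has smaller degree, so this multiple of p must vanish and f is
    -- the constant φ m.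
    have h5 : p * (C (φ m) - f) = q := by
      rw [mul_sub, h4, smul_eq_C_mul]; ring
    have h6 : C (φ m) - f = 0 := by
      by_contra hne
      rw [← h5] at hqdeg
      exact absurd (degree_le_mul_left p hne) (not_le.2 hqdeg)
    rw [← hf, ← sub_eq_zero.1 h6, C_smul_eq]

end Saturation

/-! ### Quotient representations and triangular bases. -/

section Triangular

universe u

variable {k L : Type*} {V : Type u} [Field k] [AddCommGroup L] [Module k L] [Module k[X] L]
  [IsScalarTower k k[X] L] [ConformalAlgebra k L]
  [AddCommGroup V] [Module k V] [Module k[X] V] [IsScalarTower k k[X] V]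
  {ρ : ℕ → L →ₗ[k] V →ₗ[k] V}

/-- The representation on the quotient by a subrepresentation. -/
theorem IsConformalRep.exists_quotient (hρ : IsConformalRep ρ) (W : Submodule k[X] V)
    (hW : ∀ x n, ∀ w ∈ W, ρ n x w ∈ W) :
    ∃ ρ' : ℕ → L →ₗ[k] (V ⧸ W) →ₗ[k] (V ⧸ W), IsConformalRep ρ' ∧
      ∀ n x v, ρ' n x (W.mkQ v) = W.mkQ (ρ n x v) := by
  obtain ⟨A, hA⟩ : ∃ A : ℕ → L → (V ⧸ W) →ₗ[k] (V ⧸ W),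
      ∀ n x v, A n x (W.mkQ v) = W.mkQ (ρ n x v) :=
    ⟨fun n x => (Submodule.Quotient.restrictScalarsEquiv k W).conj
      ((W.restrictScalars k).mapQ (W.restrictScalars k) (ρ n x) (hW x n)), fun n x v => rfl⟩
  have hsm : ∀ (c : k) v, W.mkQ (c • v) = c • W.mkQ v := fun c v => rfl
  obtain ⟨ρ', hρ'⟩ : ∃ ρ' : ℕ → L →ₗ[k] (V ⧸ W) →ₗ[k] (V ⧸ W),
      ∀ n x v, ρ' n x (W.mkQ v) = W.mkQ (ρ n x v) := by
    refine ⟨fun n => ⟨⟨A n, fun x y => ?_⟩, fun c x => ?_⟩, hA⟩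
    · refine LinearMap.ext fun v => ?_
      obtain ⟨v, rfl⟩ := W.mkQ_surjective v
      rw [LinearMap.add_apply, hA, hA, hA, map_add, LinearMap.add_apply, map_add]
    · refine LinearMap.ext fun v => ?_
      obtain ⟨v, rfl⟩ := W.mkQ_surjective v
      rw [RingHom.id_apply, LinearMap.smul_apply, hA, hA, map_smul, LinearMap.smul_apply, hsm]
  refine ⟨ρ', ⟨fun x v => ?_, fun n x v => ?_, fun x n v => ?_, fun n m a b v => ?_⟩, hρ'⟩
  · obtain ⟨v, rfl⟩ := W.mkQ_surjective v
    obtain ⟨N, hN⟩ := hρ.locality x v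
    exact ⟨N, fun n hn => by rw [hρ', hN n hn, map_zero]⟩
  · obtain ⟨v, rfl⟩ := W.mkQ_surjective v
    rw [hρ', hρ', hρ.D_left, map_neg, hsm]
  · obtain ⟨v, rfl⟩ := W.mkQ_surjective v
    have := hρ.sesqui x n v
    simp only at this ⊢
    rw [← map_smul, hρ', hρ', hρ', this, map_add, hsm, map_smul]
  · obtain ⟨v, rfl⟩ := W.mkQ_surjective v
    rw [hρ', hρ', hρ', hρ', ← map_sub, hρ.jacobi, map_sum]
    exact Finset.sum_congr rfl fun s _ => by rw [hsm, hρ']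

/-- Over a solvable Lie conformal algebra a finite torsion-free representation has a basis on
which the algebra acts triangularly, with constants on the diagonal. -/
theorem IsConformalRep.exists_triangular_basis [IsAlgClosed k] [CharZero k]
    [Module.Finite k[X] L] [Module.Finite k[X] V] [Module.IsTorsionFree k[X] V]
    (hρ : IsConformalRep ρ) (hs : IsSolvable k L) :
    ∃ (r : ℕ) (b : Module.Basis (Fin r) k[X] V), ∀ x n i, ∃ c : k,
      ρ n x (b i) - c • b i ∈ Submodule.span k[X] (b '' Set.Iio i) := by
  induction hd : Module.finrank k[X] V using Nat.strong_induction_on generalizing V with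
  | _ d ih =>
    rcases subsingleton_or_nontrivial V with hV | hV
    · exact ⟨0, Module.Basis.empty V, fun x n i => i.elim0⟩
    obtain ⟨v, hv0, hv⟩ := hρ.exists_eigenvector hs
    obtain ⟨w, p, rfl, hsat⟩ := exists_saturated_generator (R := k[X]) hv0
    have hp : p ≠ 0 := fun h => hv0 (by rw [h, zero_smul])
    have hw0 : w ≠ 0 := fun h => hv0 (by rw [h, smul_zero])
    have hw : ∀ x n, ∃ c : k, ρ n x w = c • w := by
      intro x n
      choose φ hφ using hv x
      exact ⟨φ n, (hρ.sesqui x).weight_of_saturated hw0 hp hφ hsat n⟩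
    set W : Submodule k[X] V := Submodule.span k[X] {w} with hWdef
    have hwW : w ∈ W := Submodule.mem_span_singleton_self w
    have hW : ∀ x n, ∀ u ∈ W, ρ n x u ∈ W := by
      intro x n u hu
      refine (hρ.sesqui x).map_span_mem ?_ hu n
      rintro _ rfl m
      obtain ⟨c, hc⟩ := hw x m
      simp only [hc]
      exact smul_mem_of_field W c hwW
    obtain ⟨ρ', hρ', hmk⟩ := hρ.exists_quotient W hW
    have : Module.IsTorsionFree k[X] (V ⧸ W) := by
      refine Module.IsTorsionFree.of_smul_eq_zero fun h s hs => ?_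
      obtain ⟨s, rfl⟩ := W.mkQ_surjective s
      by_cases hh : h = 0
      · exact Or.inl hh
      · rw [← map_smul, Submodule.mkQ_apply, Submodule.Quotient.mk_eq_zero] at hs
        exact Or.inr ((Submodule.Quotient.mk_eq_zero W).2 (hsat h s hh hs))
    have hlt : Module.finrank k[X] (V ⧸ W) < d := by
      have h1 := Submodule.finrank_quotient_add_finrank W
      have : Nontrivial W := ⟨⟨w, hwW⟩, 0, fun h => hw0 (congrArg Subtype.val h)⟩
      have h2 : 0 < Module.finrank k[X] W := Module.finrank_pos
      omega
    obtain ⟨r, b, hb⟩ := ih _ hlt hρ' rfl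
    choose s hsb using fun i => W.mkQ_surjective (b i)
    let e : Fin (r + 1) → V := Fin.cons w s
    have hli : LinearIndependent k[X] e := by
      rw [Fintype.linearIndependent_iff]
      intro g hg
      rw [Fin.sum_univ_succ] at hg
      simp only [e, Fin.cons_zero, Fin.cons_succ] at hg
      have h1 : ∑ i : Fin r, g i.succ • b i = 0 := by
        have := congrArg W.mkQ hg
        have hmw : W.mkQ w = 0 := (Submodule.Quotient.mk_eq_zero W).2 hwW
        simpa only [map_add, map_smul, map_sum, hsb, hmw, smul_zero, zero_add, map_zero] using this
      have h2 := Fintype.linearIndependent_iff.1 b.linearIndependent _ h1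
      have h3 : g 0 = 0 := by
        rw [Finset.sum_eq_zero fun i _ => by rw [h2 i, zero_smul], add_zero] at hg
        exact (smul_eq_zero.1 hg).resolve_right hw0
      exact fun i => Fin.cases h3 h2 i
    -- Lifting is ambiguous only up to multiples of w; as w comes first in e, triangularity
    -- survives.
    have hlift : ∀ (I : Set (Fin r)) (z : V), W.mkQ z ∈ Submodule.span k[X] (b '' I) →
        z ∈ Submodule.span k[X] (e '' insert 0 (Fin.succ '' I)) := by
      intro I z hz
      have h1 : b '' I = W.mkQ '' (s '' I) := by
        rw [Set.image_image]
        exact Set.image_congr fun i _ => (hsb i).symm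
      rw [h1, Submodule.span_image] at hz
      obtain ⟨y, hy, hyz⟩ := hz
      have h2 : z - y ∈ W := by
        rw [← Submodule.Quotient.mk_eq_zero, ← Submodule.mkQ_apply, map_sub, hyz, sub_self]
      obtain ⟨c, hc⟩ := Submodule.mem_span_singleton.1 h2
      have h3 : e '' insert 0 (Fin.succ '' I) = insert w (s '' I) := by
        rw [Set.image_insert_eq, Set.image_image]
        simp [e]
      rw [h3, Submodule.mem_span_insert]
      exact ⟨c, y, hy, by rw [hc, sub_add_cancel]⟩
    have hsp : ⊤ ≤ Submodule.span k[X] (Set.range e) := by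
      intro z _
      refine Submodule.span_mono (Set.image_subset_range _ _) (hlift Set.univ z ?_)
      rw [Set.image_univ, b.span_eq]
      exact Submodule.mem_top
    refine ⟨r + 1, Module.Basis.mk hli hsp, fun x n i => ?_⟩
    rw [Module.Basis.coe_mk]
    refine Fin.cases ?_ (fun i => ?_) i
    · obtain ⟨c, hc⟩ := hw x n
      refine ⟨c, ?_⟩
      simp only [e, Fin.cons_zero, hc, sub_self]
      exact zero_mem _
    · obtain ⟨c, hc⟩ := hb x n i
      refine ⟨c, ?_⟩
      rw [← hsb, hmk] at hc
      have h1 := hlift (Set.Iio i) (ρ n x (s i) - c • s i) (by rw [map_sub]; exact hc)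
      refine Submodule.span_mono (Set.image_mono ?_) h1
      rintro _ (rfl | ⟨j, hj, rfl⟩)
      · exact Fin.succ_pos i
      · exact Fin.succ_lt_succ_iff.2 hj

end Triangular

/-! ### From a triangular basis to the central PBW property. -/

section CentralPBW

variable {k L : Type*} [Field k] [AddCommGroup L] [Module k L] [Module k[X] L]
  [IsScalarTower k k[X] L] [ConformalAlgebra k L]

theorem isConformalRep_adjoint [IsLie k L] : IsConformalRep (nprod (k := k) (L := L)) where
  locality := locality
  D_left := D_nprod
  sesqui x n v := nprod_D n x v
  jacobi := IsLie.jacobi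

variable {ι : Type*} (b : Module.Basis ι k[X] L)

/-- Each D moved across the tensor sign becomes -d/dt and lowers the power of t by one. -/
theorem coeffMk_X_pow_smul_mem {N : ι → ℕ} {i : ι} (e : ℕ) {M : ℕ} (h : N i + e ≤ M) :
    coeffMk k (X ^ M) ((X : k[X]) ^ e • b i) ∈ centralSpan b N := by
  induction e generalizing M with
  | zero =>
    rw [pow_zero, one_smul]
    exact Submodule.subset_span ⟨i, M, h, rfl⟩
  | succ e ih =>
    have hd : derivative (X ^ M : k[X]) = (M : k) • X ^ (M - 1) := by
      rw [derivative_X_pow, smul_eq_C_mul]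
    rw [pow_succ', mul_smul, coeffMk_smul, hd, ← coeffMkₗ_apply,
      LinearMap.map_smul (coeffMkₗ k), LinearMap.smul_apply]
    exact neg_mem (Submodule.smul_mem _ _ (ih (by omega)))

theorem coeffMk_smul_mem {N : ι → ℕ} {i : ι} {p : k[X]} {M : ℕ} (h : N i + p.natDegree ≤ M) :
    coeffMk k (X ^ M) (p • b i) ∈ centralSpan b N := by
  rw [p.as_sum_range, Finset.sum_smul, ← coeffMkₗ_apply, map_sum]
  refine sum_mem fun e he => ?_
  have := Finset.mem_range.1 he
  rw [← C_mul_X_pow_eq_monomial, mul_smul, C_smul_eq, map_smul]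
  exact Submodule.smul_mem _ _ (coeffMk_X_pow_smul_mem b e (by omega))

/-- The degrees of the coordinates of all products with basis elements are bounded. -/
theorem exists_natDegree_bound [Finite ι] :
    ∃ d : ℕ, ∀ x n i j, (b.repr (nprod (k := k) n x (b i)) j).natDegree ≤ d := by
  classical
  have := Fintype.ofFinite ι
  choose N hN using fun l i => locality (k := k) (b l) (b i)
  let d := Finset.univ.sup fun l => Finset.univ.sup fun i => (Finset.range (N l i)).sup fun n =>
    Finset.univ.sup fun j => (b.repr (nprod (k := k) n (b l) (b i)) j).natDegree
  refine ⟨d, ?_⟩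
  have hb : ∀ l n i j, (b.repr (nprod (k := k) n (b l) (b i)) j).natDegree ≤ d := by
    intro l n i j
    rcases le_or_gt (N l i) n with h | h
    · simp [hN l i n h]
    · exact (((Finset.le_sup (f := fun j =>
        (b.repr (nprod (k := k) n (b l) (b i)) j).natDegree) (Finset.mem_univ j)).trans
        (Finset.le_sup (f := fun n => Finset.univ.sup fun j =>
          (b.repr (nprod (k := k) n (b l) (b i)) j).natDegree) (Finset.mem_range.2 h))).trans
        (Finset.le_sup (f := fun i => (Finset.range (N l i)).sup fun n => Finset.univ.sup fun j =>
          (b.repr (nprod (k := k) n (b l) (b i)) j).natDegree) (Finset.mem_univ i))).trans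
        (Finset.le_sup (f := fun l => Finset.univ.sup fun i =>
          (Finset.range (N l i)).sup fun n => Finset.univ.sup fun j =>
          (b.repr (nprod (k := k) n (b l) (b i)) j).natDegree) (Finset.mem_univ l))
  have hsmul : ∀ (c : k) (z : L) j, b.repr (c • z) j = c • b.repr z j := by
    intro c z j
    rw [← C_smul_eq, map_smul, Finsupp.smul_apply, smul_eq_mul, smul_eq_C_mul]
  let S : Submodule k L :=
    { carrier := {x | ∀ n i j, (b.repr (nprod (k := k) n x (b i)) j).natDegree ≤ d}
      add_mem' := fun {x y} hx hy n i j => by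
        rw [map_add, LinearMap.add_apply, map_add, Finsupp.add_apply]
        exact natDegree_add_le_of_degree_le (hx n i j) (hy n i j)
      zero_mem' := fun n i j => by simp
      smul_mem' := fun c x hx n i j => by
        rw [map_smul, LinearMap.smul_apply, hsmul]
        exact (natDegree_smul_le _ _).trans (hx n i j) }
  -- D in the left factor only rescales a product and lowers its index, so a bound over basis
  -- elements x, where locality leaves finitely many indices, holds for all x.
  have hS : ∀ x ∈ S, (X : k[X]) • x ∈ S := by
    intro x hx n i j
    rw [D_nprod, map_neg, Finsupp.neg_apply, natDegree_neg, hsmul]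
    exact (natDegree_smul_le _ _).trans (hx (n - 1) i j)
  have htop : (⊤ : Submodule k[X] L) ≤ submoduleOfXSMul S hS := by
    rw [← b.span_eq, Submodule.span_le]
    rintro _ ⟨l, rfl⟩
    exact fun n i j => hb l n i j
  exact fun x => htop (Submodule.mem_top : x ∈ ⊤)

theorem hasCentralPBW_of_triangular {r : ℕ} (b : Module.Basis (Fin r) k[X] L)
    (hb : ∀ x n i, ∃ c : k, nprod (k := k) n x (b i) - c • b i ∈
      Submodule.span k[X] (b '' Set.Iio i)) : HasCentralPBW b := by
  classical
  obtain ⟨d, hd⟩ := exists_natDegree_bound b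
  -- Steps of d absorb the degrees of the coordinates below the diagonal index; the 1 makes N
  -- positive at i = 0.
  refine ⟨fun i => 1 + i * d, fun i => Nat.add_pos_left one_pos _, fun n x u hu => ?_⟩
  set N : Fin r → ℕ := fun i => 1 + i * d with hN
  have key : ∀ x n i M, N i ≤ M →
      coeffMk k (X ^ M) (nprod (k := k) n x (b i)) ∈ centralSpan b N := by
    intro x n i M hM
    obtain ⟨c, hc⟩ := hb x n i
    rw [b.mem_span_image] at hc
    rw [← b.sum_repr (nprod (k := k) n x (b i)), ← coeffMkₗ_apply, map_sum]
    refine sum_mem fun j _ => ?_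
    rcases lt_trichotomy j i with hji | rfl | hij
    · refine coeffMk_smul_mem b ?_
      have h1 := hd x n i j
      have h2 : (j + 1 : ℕ) * d ≤ i * d := Nat.mul_le_mul_right d hji
      simp only [hN] at hM ⊢
      rw [Nat.add_mul, Nat.one_mul] at h2
      omega
    · have h1 : b.repr (nprod (k := k) n x (b j) - c • b j) j = 0 := by
        by_contra h
        exact lt_irrefl j (hc (Finsupp.mem_support_iff.2 h))
      rw [← C_smul_eq, map_sub, map_smul, Finsupp.sub_apply, Finsupp.smul_apply, b.repr_self,
        Finsupp.single_eq_same, smul_eq_mul, mul_one, sub_eq_zero] at h1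
      refine coeffMk_smul_mem b ?_
      rw [h1, natDegree_C]
      exact hM
    · have h1 : b.repr (nprod (k := k) n x (b i) - c • b i) j = 0 := by
        by_contra h
        exact lt_asymm hij (hc (Finsupp.mem_support_iff.2 h))
      rw [← C_smul_eq, map_sub, map_smul, Finsupp.sub_apply, Finsupp.smul_apply, b.repr_self,
        Finsupp.single_eq_of_ne hij.ne', smul_zero, sub_zero] at h1
      rw [h1, zero_smul, map_zero]
      exact zero_mem _
  induction hu using Submodule.span_induction with
  | mem u hu =>
    obtain ⟨i, m, hm, rfl⟩ := hu
    rw [centralAction_mk]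
    exact sum_mem fun s _ => Submodule.smul_mem _ _ (key x _ i _ (hm.trans (Nat.le_add_right m s)))
  | zero => rw [map_zero]; exact zero_mem _
  | add u v _ _ hu hv => rw [map_add]; exact add_mem hu hv
  | smul c u _ hu => rw [map_smul]; exact Submodule.smul_mem _ c hu

end CentralPBW

end ConformalAlgebra

theorem mainTheorem3 {k : Type*} [Field k] [CharZero k] [IsAlgClosed k]
    {L : Type*} [AddCommGroup L] [Module k L] [Module k[X] L] [IsScalarTower k k[X] L]
    [ConformalAlgebra k L] [ConformalAlgebra.IsLie k L]
    [Module.Finite k[X] L] [Module.IsTorsionFree k[X] L]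
    (hsolv : ConformalAlgebra.IsSolvable k L) :
    ∃ (r : ℕ) (b : Module.Basis (Fin r) k[X] L), ConformalAlgebra.HasCentralPBW b := by
  obtain ⟨r, b, hb⟩ :=
    (ConformalAlgebra.isConformalRep_adjoint (k := k) (L := L)).exists_triangular_basis hsolv
  exact ⟨r, b, ConformalAlgebra.hasCentralPBW_of_triangular b hb⟩
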